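/- Consider an $N$-armed restless bandit, $N\ge 1$: each arm is a copy of a Markov decision process with finite state space $\mathbb S$, actions $\{0,1\}$, transition kernel $P(s,a,s')$ and reward $r(s,a)$; given the current states and actions the arms move independently; and at every time exactly $\alpha N$ arms must be given action $1$, where $0<\alpha<1$ and $\alpha N$ is an integer. For a (randomized, history-dependent) policy $\pi$ and initial state vector $\boldsymbol S_0\in\mathbb S^N$, let $$R^-(\pi,\boldsymbol S_0)=\liminf_{T\to\infty}\frac1T\sum_{t=0}^{T-1}\frac1N\sum_{i=1}^N\mathbb E\big[r(S_t(i),A_t(i))\big],$$ write $R(\pi,\boldsymbol S_0)$ for the limit when it exists, and let $R^*(N,\boldsymbol S_0)$ be the supremum of $R^-(\pi,\boldsymbol S_0)$ over all policies satisfying $\sum_i A_t(i)=\alpha N$ almost surely for all $t\ge0$. Let $y^*$ be an optimal solution of the linear program: maximize $\sum_{s,a}r(s,a)y(s,a)$ subject to $\sum_s y(s,1)=\alpha$; $\sum_{s',a}y(s',a)P(s',a,s)=\sum_a y(s,a)$ for all $s$; $\sum_{s,a}y(s,a)=1$; $y\ge0$. Let $\bar\pi^*(a|s)=y^*(s,a)/(y^*(s,0)+y^*(s,1))$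 if the denominator is positive and $\bar\pi^*(a|s)=1/2$ otherwise, and let $P_{\bar\pi^*}(s,s')=\sum_a\bar\pi^*(a|s)P(s,a,s')$. Assume that $P_{\bar\pi^*}$ is an aperiodic unichain: it has a single recurrent class, which is aperiodic, and possibly transient states. The ID policy does the following at every time $t$: sample ideal actions $\hat A_t(i)\sim\bar\pi^*(\cdot|S_t(i))$ independently for $i=1,\dots,N$. If $\sum_{i=1}^N\hat A_t(i)\ge\alpha N$, let $n^*=\max\{n\le N:\sum_{i=1}^n\hat A_t(i)\le\alpha N\}$, and set $A_t(i)=\hat A_t(i)$ for $i\le n^*$ and $A_t(i)=0$ for $i>n^*$. Otherwise let $n^*=\max\{n\le N:\sum_{i=1}^n(1-\hat A_t(i))\le(1-\alpha)N\}$, and set $A_t(i)=\hat A_t(i)$ for $i\le n^*$ and $A_t(i)=1$ for $i>n^*$. Then $P_{\bar\pi^*}$ has a unique stationary distribution $\mu^*$; with $\Xi$ the matrix all of whose rows are $\mu^*$, the series $W=\sum_{k\ge0}(P_{\bar\pi^*}-\Xi)^k(P_{\bar\pi^*}^{\top}-\Xi^{\top})^k$ converges and has a largest eigenvalue $\lambda_W$;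 and for every $N\ge1$ with $\alpha N$ an integer and every $\boldsymbol S_0\in\mathbb S^N$, the ID policy $\pi$ satisfies the budget constraint, the limit $R(\pi,\boldsymbol S_0)$ exists, and $$R^*(N,\boldsymbol S_0)-R(\pi,\boldsymbol S_0)\le\frac{C_{\mathrm{ID}}}{\sqrt N},\qquad C_{\mathrm{ID}}=\frac{672\,r_{\max}\,\lambda_W^{5/2}\,|\mathbb S|^{3/2}}{\beta^3},$$ where $r_{\max}=\max_{s,a}|r(s,a)|$ and $\beta=\min\{\alpha,1-\alpha\}$. -/

import Mathlib

open Filter Topology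

namespace RestlessBandit

noncomputable section

/-! Finite probability -/

/-- The joint law of independent random variables `X i`, `i : ι`, where `X i` has law `p i`. -/
def indepPMF {ι β : Type*} [Fintype ι] [DecidableEq ι] [Fintype β] (p : ι → PMF β) :
    PMF (ι → β) :=
  PMF.ofFintype (fun x => ∏ i, p i (x i)) (by
    rw [← Fintype.prod_sum]
    refine Finset.prod_eq_one fun i _ => ?_
    exact (tsum_fintype (p i)).symm.trans (p i).tsum_coe)

/-- Expectation of a real function under a law on a finite set. -/
def expect {Ω : Type*} [Fintype Ω] (p : PMF Ω) (f : Ω → ℝ) : ℝ :=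
  ∑ x, (p x).toReal * f x

/-! Finite Markov chains -/

section MarkovChain

variable {S : Type*} [Fintype S] [DecidableEq S]

/-- `s'` is accessible from `s` for the transition matrix `Q`. -/
def Accessible (Q : Matrix S S ℝ) (s s' : S) : Prop :=
  ∃ n : ℕ, 0 < (Q ^ n) s s'

/-- A state of a finite chain is recurrent if it is accessible from every state
that is accessible from it. -/
def IsRecurrent (Q : Matrix S S ℝ) (s : S) : Prop :=
  ∀ s', Accessible Q s s' → Accessible Q s' s

/-- The transition matrix `Q` has exactly one recurrent class (and possibly transient states),
and this class is aperiodic: the greatest common divisor of the return times of each of its states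
is one. -/
structure IsAperiodicUnichain (Q : Matrix S S ℝ) : Prop where
  exists_recurrent : ∃ s, IsRecurrent Q s
  single_class : ∀ s s', IsRecurrent Q s → IsRecurrent Q s' → Accessible Q s s'
  aperiodic : ∀ s, IsRecurrent Q s →
    ∀ d : ℕ, (∀ n : ℕ, 0 < n → 0 < (Q ^ n) s s → d ∣ n) → d = 1

/-- `μ` is a stationary probability distribution (a row vector) of `Q`. -/
def IsStationary (Q : Matrix S S ℝ) (μ : S → ℝ) : Prop :=
  (∀ s, 0 ≤ μ s) ∧ ∑ s, μ s = 1 ∧ Matrix.vecMul μ Q = μ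

/-- The matrix all of whose rows are `μ`. -/
def constRows (μ : S → ℝ) : Matrix S S ℝ := Matrix.of fun _ s => μ s

/-- `W = ∑ₖ (Q - Ξ)ᵏ (Qᵀ - Ξᵀ)ᵏ` (a convergent series), where all rows of `Ξ` are `μ`. -/
def IsWeightMatrix (Q : Matrix S S ℝ) (μ : S → ℝ) (W : Matrix S S ℝ) : Prop :=
  HasSum (fun k : ℕ =>
    (Q - constRows μ) ^ k * (Q.transpose - (constRows μ).transpose) ^ k) W

/-- `l` is the largest real eigenvalue of `W`. -/
def IsMaxEigenvalue (W : Matrix S S ℝ) (l : ℝ) : Prop :=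
  IsGreatest {x : ℝ | Module.End.HasEigenvalue (Matrix.toLin' W) x} l

end MarkovChain

/-! The single-armed MDP and its linear program -/

/-- A Markov decision process with state space `S` and action space `{0, 1}`: transition kernel and
reward function. -/
structure MDP (S : Type*) where
  trans : S → Fin 2 → PMF S
  reward : S → Fin 2 → ℝ

section LP

variable {S : Type*} [Fintype S] (M : MDP S)

/-- The transition probability `P(s, a, s')` as a real number. -/
def MDP.P (s : S) (a : Fin 2) (s' : S) : ℝ := (M.trans s a s').toReal

/-- The maximum of `|r(s, a)|` over all states and actions. -/
def MDP.rmax : ℝ := ⨆ x : S × Fin 2, |M.reward x.1 x.2|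

/-- Feasibility for the linear-programming relaxation with budget `α`. -/
structure IsLPFeasible (α : ℝ) (y : S → Fin 2 → ℝ) : Prop where
  budget : ∑ s, y s 1 = α
  balance : ∀ s, ∑ s', ∑ a, y s' a * M.P s' a s = ∑ a, y s a
  total : ∑ s, ∑ a, y s a = 1
  nonneg : ∀ s a, 0 ≤ y s a

/-- The objective of the linear program. -/
def lpValue (y : S → Fin 2 → ℝ) : ℝ := ∑ s, ∑ a, M.reward s a * y s a

/-- Optimality for the linear-programming relaxation. -/
structure IsLPOptimal (α : ℝ) (y : S → Fin 2 → ℝ) : Prop where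
  feasible : IsLPFeasible M α y
  optimal : ∀ z, IsLPFeasible M α z → lpValue M z ≤ lpValue M y

/-- The probability with which the single-armed policy induced by `y` takes action `a`
in state `s`. -/
def singleArmProb (y : S → Fin 2 → ℝ) (s : S) (a : Fin 2) : ℝ :=
  if 0 < y s 0 + y s 1 then y s a / (y s 0 + y s 1) else 1 / 2

/-- The transition matrix induced by that policy in the single-armed MDP. -/
def singleArmMatrix (y : S → Fin 2 → ℝ) : Matrix S S ℝ :=
  Matrix.of fun s s' => ∑ a, singleArmProb y s a * M.P s a s'

end LP

/-! The `N`-armed problem -/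

section NArm

variable {S : Type*} [Fintype S]

/-- Joint actions of `N` arms; arm `i : Fin N` has ID `i + 1`. -/
abbrev Actions (N : ℕ) : Type := Fin N → Fin 2

/-- The number of arms that are pulled. -/
def pulls {N : ℕ} (a : Actions N) : ℕ := ∑ i, (a i : ℕ)

/-- What has been observed when the action of time `t` is chosen: the state vectors and action
vectors at times `0, …, t - 1`, and the current state vector. -/
abbrev History (S : Type*) (N t : ℕ) : Type _ :=
  (Fin t → (Fin N → S) × Actions N) × (Fin N → S)

/-- A randomized history-dependent policy for the `N`-armed problem. -/
abbrev Policy (S : Type*) (N : ℕ) : Type _ :=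
  ∀ t : ℕ, History S N t → PMF (Actions N)

variable (M : MDP S) {N : ℕ}

/-- Given states and actions, the arms make independent transitions. -/
def nextStates (s : Fin N → S) (a : Actions N) : PMF (Fin N → S) :=
  indepPMF fun i => M.trans (s i) (a i)

/-- The law of the history at time `t` under the policy `π`, from the initial state vector `s₀`. -/
def historyLaw (π : Policy S N) (s₀ : Fin N → S) : (t : ℕ) → PMF (History S N t)
  | 0 => PMF.pure (fun i => i.elim0, s₀)
  | t + 1 => (historyLaw π s₀ t).bind fun h => (π t h).bind fun a =>
      (nextStates M h.2 a).map fun s' =>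
        (Fin.snoc (α := fun _ => (Fin N → S) × Actions N) h.1 (h.2, a), s')

/-- The joint law of the state vector and the action vector at time `t`. -/
def stateActionLaw (π : Policy S N) (s₀ : Fin N → S) (t : ℕ) : PMF ((Fin N → S) × Actions N) :=
  (historyLaw M π s₀ t).bind fun h => (π t h).map fun a => (h.2, a)

/-- The expected average reward per arm over the first `T` steps. -/
def avgReward (π : Policy S N) (s₀ : Fin N → S) (T : ℕ) : ℝ :=
  (1 / (T : ℝ)) * ∑ t ∈ Finset.range T, (1 / (N : ℝ)) * ∑ i,
    expect (stateActionLaw M π s₀ t) fun x => M.reward (x.1 i) (x.2 i)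

/-- The liminf average reward. -/
def liminfReward (π : Policy S N) (s₀ : Fin N → S) : ℝ :=
  liminf (fun T => avgReward M π s₀ T) atTop

/-- The budget constraint: almost surely, exactly `α N` arms are pulled at every time. -/
def MeetsBudget (α : ℝ) (π : Policy S N) (s₀ : Fin N → S) : Prop :=
  ∀ t, ∀ x ∈ (stateActionLaw M π s₀ t).support, (pulls x.2 : ℝ) = α * N

/-- The optimal reward of the `N`-armed problem: the supremum of the liminf average reward over all
policies that meet the budget constraint. -/
def optReward (N : ℕ) (α : ℝ) (s₀ : Fin N → S) : ℝ :=
  sSup {R : ℝ | ∃ π : Policy S N, MeetsBudget M α π s₀ ∧ liminfReward M π s₀ = R}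

end NArm

/-! The ID policy -/

section IDPolicy

variable {N : ℕ}

/-- The number of action `1`'s among the arms with IDs `1, …, n`. -/
def prefixOnes (a : Actions N) (n : ℕ) : ℕ := ∑ i with i.val < n, (a i : ℕ)

/-- The number of action `0`'s among the arms with IDs `1, …, n`. -/
def prefixZeros (a : Actions N) (n : ℕ) : ℕ := ∑ i with i.val < n, (1 - (a i : ℕ))

open Classical in
/-- The action rectification of the ID policy, applied to the vector `a` of ideal actions.
`Nat.findGreatest Q N` is the largest `n ≤ N` with `Q n` (here `Q 0` holds). -/
def idRectify (α : ℝ) (a : Actions N) : Actions N :=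
  if α * N ≤ (pulls a : ℝ) then
    fun i => if i.val < Nat.findGreatest (fun n => (prefixOnes a n : ℝ) ≤ α * N) N
      then a i else 0
  else
    fun i => if i.val < Nat.findGreatest (fun n => (prefixZeros a n : ℝ) ≤ (1 - α) * N) N
      then a i else 1

variable {S : Type*} [Fintype S] {M : MDP S} {α : ℝ} {y : S → Fin 2 → ℝ}

/-- The law of the ideal action of an arm in state `s`. -/
def idealAction (hy : IsLPFeasible M α y) (s : S) : PMF (Fin 2) :=
  PMF.ofFintype (fun a => ENNReal.ofReal (singleArmProb y s a)) (by
    have h0 := hy.nonneg s 0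
    have h1 := hy.nonneg s 1
    rw [Fin.sum_univ_two, ← ENNReal.ofReal_add, ENNReal.ofReal_eq_one]
    · unfold singleArmProb
      split_ifs with h
      · rw [← add_div, div_self h.ne']
      · norm_num
    all_goals
      unfold singleArmProb
      split_ifs <;> positivity)

/-- The ID policy: at every time, ideal actions are sampled independently from the single-armed
policy at the current states, and then rectified. -/
def idPolicy (N : ℕ) (hy : IsLPFeasible M α y) : Policy S N :=
  fun _ h => (indepPMF fun i => idealAction hy (h.2 i)).map (idRectify α)

end IDPolicy

end

end RestlessBandit

namespace RestlessBandit

noncomputable section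

/-! Expectations under laws on finite sets -/

section Expect

variable {Ω Ω' : Type*} [Fintype Ω] [Fintype Ω']

/-! The value of the linear program separates the two sides of the inequality. It bounds the reward
of every policy that meets the budget: the time-averaged state-action occupancy satisfies the budget
and normalization exactly and the balance equations up to `1 / T`, so its limit points are feasible
(`IsLPOptimal.liminfReward_le`). It remains to show that the ID policy loses only `O(1 / √N)`
against this value.

For the loss, send state `s` to `u s = L (e_s - μ)`, where `‖L v‖ ^ 2` is the quadratic form of `W`.
Summing `u` over a group of arms measures how far their empirical distribution is from `μ`, and one
step of the single-armed chain contracts this quantity by `1 - 1 / (2 * l)`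
(`IsWeightMatrix.exists_isArmEmbedding`). Call a prefix of the arms focused if all its sub-prefixes
deviate by at most `b` times the number of remaining arms. The Lyapunov function `unfocused` counts
the arms outside the longest such prefix.

The value of `b` is chosen so that on a focused prefix the ideal actions nearly fit the budget.
Rectification therefore alters few arms beyond the unfocused ones
(`IsArmEmbedding.exists_followed_prefix`). On the prefix that is both focused and followed, the arms
evolve as independent copies of the single-armed chain. Deviations there contract up to noise, and
the slack lets the focused prefix grow (`unfocused_le_of_contraction`). All prefixes must be
controlled at once, so the noise is a maximum of partial sums of independent centered vectors, of
mean `O(√N)` by `expect_maxPartial_le`.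

Hence `unfocused` has negative drift up to `O(√N)`, and its long-run mean is `O(√N)`
(`sub_le_of_drift`). The one-step reward gap per arm is `O(unfocused / N + 1 / √N)` by
`IsArmEmbedding.lpValue_sub_idReward_le`, and `gap_constant_le` collects the constants. The joint
chain need not be ergodic, so the existence of the average reward comes from the mean ergodic
theorem (`exists_tendsto_cesaro`). -/

theorem sum_toReal (p : PMF Ω) : ∑ x, (p x).toReal = 1 := by
  rw [← ENNReal.toReal_sum fun x _ => p.apply_ne_top x, ← tsum_fintype (L := .unconditional _),
    p.tsum_coe, ENNReal.toReal_one]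

theorem expect_const (p : PMF Ω) (c : ℝ) : expect p (fun _ => c) = c := by
  simp [expect, ← Finset.sum_mul, sum_toReal]

theorem expect_add (p : PMF Ω) (f g : Ω → ℝ) :
    expect p (fun x => f x + g x) = expect p f + expect p g := by
  simp [expect, mul_add, Finset.sum_add_distrib]

theorem expect_sub (p : PMF Ω) (f g : Ω → ℝ) :
    expect p (fun x => f x - g x) = expect p f - expect p g := by
  simp [expect, mul_sub, Finset.sum_sub_distrib]

theorem expect_const_mul (p : PMF Ω) (c : ℝ) (f : Ω → ℝ) :
    expect p (fun x => c * f x) = c * expect p f := by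
  simp only [expect, Finset.mul_sum]
  exact Finset.sum_congr rfl fun x _ => by ring

theorem expect_sum {ι : Type*} (s : Finset ι) (p : PMF Ω) (f : ι → Ω → ℝ) :
    expect p (fun x => ∑ i ∈ s, f i x) = ∑ i ∈ s, expect p (f i) := by
  simp only [expect, Finset.mul_sum]
  exact Finset.sum_comm

theorem expect_mono (p : PMF Ω) {f g : Ω → ℝ} (h : ∀ x, f x ≤ g x) : expect p f ≤ expect p g :=
  Finset.sum_le_sum fun x _ => mul_le_mul_of_nonneg_left (h x) ENNReal.toReal_nonneg

theorem expect_congr_support (p : PMF Ω) {f g : Ω → ℝ} (h : ∀ x ∈ p.support, f x = g x) :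
    expect p f = expect p g := by
  refine Finset.sum_congr rfl fun x _ => ?_
  by_cases hx : x ∈ p.support
  · rw [h x hx]
  · rw [PMF.mem_support_iff, not_not] at hx
    simp [hx]

theorem expect_bind (p : PMF Ω) (f : Ω → PMF Ω') (g : Ω' → ℝ) :
    expect (p.bind f) g = expect p fun x => expect (f x) g := by
  simp only [expect, PMF.bind_apply, tsum_fintype, Finset.mul_sum]
  rw [Finset.sum_comm]
  refine Finset.sum_congr rfl fun y _ => ?_
  rw [ENNReal.toReal_sum fun x _ => ENNReal.mul_ne_top (p.apply_ne_top x) ((f x).apply_ne_top y),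
    Finset.sum_mul]
  exact Finset.sum_congr rfl fun x _ => by rw [ENNReal.toReal_mul]; ring

theorem expect_pure (x : Ω) (g : Ω → ℝ) : expect (PMF.pure x) g = g x := by
  classical
  simp only [expect, PMF.pure_apply]
  rw [Finset.sum_eq_single x]
  · simp
  · intro b _ hb; simp [hb]
  · simp

theorem expect_map (p : PMF Ω) (f : Ω → Ω') (g : Ω' → ℝ) :
    expect (p.map f) g = expect p fun x => g (f x) := by
  rw [← PMF.bind_pure_comp, expect_bind]
  simp only [Function.comp, expect_pure]

theorem indepPMF_toReal {ι : Type*} [Fintype ι] [DecidableEq ι] (p : ι → PMF Ω) (x : ι → Ω) :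
    (indepPMF p x).toReal = ∏ i, (p i (x i)).toReal := by
  simp [indepPMF, ENNReal.toReal_prod]

theorem expect_indepPMF_succ {n : ℕ} (p : Fin (n + 1) → PMF Ω) (f : (Fin (n + 1) → Ω) → ℝ) :
    expect (indepPMF p) f =
      expect (p 0) fun a => expect (indepPMF fun i => p i.succ) fun x => f (Fin.cons a x) := by
  simp only [expect, indepPMF_toReal, Finset.mul_sum]
  rw [← Fintype.sum_prod_type'
    (f := fun a x => (p 0 a).toReal * ((∏ i : Fin n, (p i.succ (x i)).toReal) * f (Fin.cons a x)))]
  refine (Fintype.sum_equiv (Fin.consEquiv fun _ => Ω) _ _ fun x => ?_).symm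
  rw [Fin.prod_univ_succ]
  simp [Fin.consEquiv, mul_assoc]

theorem expect_indepPMF_zero (p : Fin 0 → PMF Ω) (f : (Fin 0 → Ω) → ℝ) :
    expect (indepPMF p) f = f Fin.elim0 := by
  simp only [expect, indepPMF_toReal]
  rw [Fintype.sum_eq_single Fin.elim0 fun x hx => (hx (Subsingleton.elim _ _)).elim]
  simp

/-- The marginals of `indepPMF p`. -/
theorem expect_indepPMF_apply {n : ℕ} (p : Fin n → PMF Ω) (i : Fin n) (f : Ω → ℝ) :
    expect (indepPMF p) (fun x => f (x i)) = expect (p i) f := by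
  induction n with
  | zero => exact i.elim0
  | succ n ih =>
    rw [expect_indepPMF_succ]
    refine Fin.cases ?_ (fun j => ?_) i
    · simp [expect_const]
    · simp only [Fin.cons_succ]
      rw [ih (fun i => p i.succ) j, expect_const]

/-- Jensen's inequality for a centered perturbation; it handles the term linear in the norm in the
maximal inequality. -/
theorem norm_le_expect_norm_add {E : Type*} [NormedAddCommGroup E] [NormedSpace ℝ E] (p : PMF Ω)
    (z : Ω → E) (hz : ∑ a, (p a).toReal • z a = 0) (x : E) :
    ‖x‖ ≤ expect p fun a => ‖x + z a‖ := by
  have : x = ∑ a, (p a).toReal • (x + z a) := by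
    simp only [smul_add, Finset.sum_add_distrib, hz, ← Finset.sum_smul, sum_toReal]
    simp
  calc ‖x‖ = ‖∑ a, (p a).toReal • (x + z a)‖ := by rw [← this]
    _ ≤ ∑ a, ‖(p a).toReal • (x + z a)‖ := norm_sum_le _ _
    _ = _ := by
      refine Finset.sum_congr rfl fun a _ => ?_
      rw [norm_smul, Real.norm_of_nonneg ENNReal.toReal_nonneg]

theorem expect_norm_add_sq {E : Type*} [NormedAddCommGroup E] [InnerProductSpace ℝ E] (p : PMF Ω)
    (z : Ω → E) (hz : ∑ a, (p a).toReal • z a = 0) (x : E) :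
    expect p (fun a => ‖x + z a‖ ^ 2) = ‖x‖ ^ 2 + expect p fun a => ‖z a‖ ^ 2 := by
  have h : expect p (fun a => inner ℝ x (z a)) = 0 := by
    simp only [expect, ← real_inner_smul_right, ← inner_sum, hz, inner_zero_right]
  simp only [norm_add_sq_real]
  rw [expect_add, expect_add, expect_const, expect_const_mul, h]
  ring

end Expect

/-! A maximal inequality for sums of independent vectors -/

section Maximal

variable {E : Type*} [NormedAddCommGroup E]

/-- The maximum of `m` and of the norms of the partial sums `x + z 0 + ⋯ + z k`. -/
def maxPartial : (n : ℕ) → (Fin n → E) → E → ℝ → ℝ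
  | 0, _, _, m => m
  | n + 1, z, x, m => maxPartial n (fun i => z i.succ) (x + z 0) (max m ‖x + z 0‖)

theorem le_maxPartial (n : ℕ) (z : Fin n → E) (x : E) (m : ℝ) : m ≤ maxPartial n z x m := by
  induction n generalizing x m with
  | zero => exact le_rfl
  | succ n ih => exact (le_max_left _ _).trans (ih _ _ _)

theorem norm_prefix_le_maxPartial (n : ℕ) (z : Fin n → E) (x : E) (m : ℝ) (hm : ‖x‖ ≤ m) (k : ℕ) :
    ‖x + ∑ i : Fin n with i.val < k, z i‖ ≤ maxPartial n z x m := by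
  induction n generalizing x m k with
  | zero => simpa [maxPartial] using hm
  | succ n ih =>
    cases k with
    | zero => simpa using hm.trans (le_maxPartial _ _ _ _)
    | succ k =>
      have := ih (fun i => z i.succ) (x + z 0) (max m ‖x + z 0‖) (le_max_right _ _) k
      rw [Finset.sum_filter] at this ⊢
      rw [Fin.sum_univ_succ]
      simpa [maxPartial, add_assoc] using this

variable [InnerProductSpace ℝ E] {Ω : Type*} [Fintype Ω]

/-- A Bellman-function proof of Doob's `L²` inequality. The right side exceeds `m ^ 2` by `(m - 2 *
‖x‖) ^ 2` when `n = 0`. Replacing `m` by a larger `‖x‖` lowers it by `2 * (m - ‖x‖) ^ 2`. A centered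
step increases the mean of its quadratic part by at most `4 * σ ^ 2` and, by Jensen, cannot increase
the mean of `-4 * m * ‖x‖`. Starting from `x = 0`, `m = 0` leaves `4 * n * σ ^ 2`. -/
theorem expect_maxPartial_sq_le (n : ℕ) (p : Fin n → PMF Ω) (z : Fin n → Ω → E) (σ : ℝ)
    (hz : ∀ i, ∑ a, (p i a).toReal • z i a = 0) (hσ : ∀ i a, ‖z i a‖ ≤ σ) (x : E) (m : ℝ)
    (hm : 0 ≤ m) :
    expect (indepPMF p) (fun ω => maxPartial n (fun i => z i (ω i)) x m ^ 2) ≤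
      2 * m ^ 2 - 4 * m * ‖x‖ + 4 * ‖x‖ ^ 2 + 4 * n * σ ^ 2 := by
  induction n generalizing x m with
  | zero =>
    rw [expect_indepPMF_zero]
    simp only [maxPartial, CharP.cast_eq_zero]
    nlinarith [sq_nonneg (m - 2 * ‖x‖)]
  | succ n ih =>
    rw [expect_indepPMF_succ]
    have h1 : ∀ a, expect (indepPMF fun i => p i.succ)
        (fun ω => maxPartial (n + 1) (fun i => z i ((Fin.cons a ω : Fin (n + 1) → Ω) i)) x m ^ 2) ≤
        2 * m ^ 2 - 4 * m * ‖x + z 0 a‖ + 4 * ‖x + z 0 a‖ ^ 2 + 4 * n * σ ^ 2 := by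
      intro a
      simp only [maxPartial, Fin.cons_zero, Fin.cons_succ]
      refine (ih (fun i => p i.succ) (fun i => z i.succ) (fun i => hz _) (fun i => hσ _)
        (x + z 0 a) (max m ‖x + z 0 a‖) (hm.trans (le_max_left _ _))).trans ?_
      rcases le_total m ‖x + z 0 a‖ with h | h
      · rw [max_eq_right h]; nlinarith [sq_nonneg (m - ‖x + z 0 a‖)]
      · rw [max_eq_left h]
    refine (expect_mono _ h1).trans ?_
    have h2 : expect (p 0) (fun a => ‖z 0 a‖ ^ 2) ≤ σ ^ 2 :=
      (expect_mono _ fun a => pow_le_pow_left₀ (norm_nonneg _) (hσ 0 a) 2).trans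
        (expect_const _ _).le
    have h3 := norm_le_expect_norm_add (p 0) (z 0) (hz 0) x
    have h4 := expect_norm_add_sq (p 0) (z 0) (hz 0) x
    rw [expect_add, expect_add, expect_sub, expect_const, expect_const, expect_const_mul,
      expect_const_mul, h4]
    push_cast
    nlinarith [mul_le_mul_of_nonneg_left h3 hm]

/-- Doob's maximal inequality for sums of independent centered bounded vectors. -/
theorem expect_maxPartial_le (n : ℕ) (hn : 0 < n) (p : Fin n → PMF Ω) (z : Fin n → Ω → E) (σ : ℝ)
    (hz : ∀ i, ∑ a, (p i a).toReal • z i a = 0) (hσ0 : 0 < σ) (hσ : ∀ i a, ‖z i a‖ ≤ σ) :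
    expect (indepPMF p) (fun ω => maxPartial n (fun i => z i (ω i)) 0 0) ≤ 2 * σ * √n := by
  have h := expect_maxPartial_sq_le n p z σ hz hσ 0 0 le_rfl
  have hn' : 0 < √(n : ℝ) := Real.sqrt_pos.2 (by exact_mod_cast hn)
  set c := 2 * σ * √n with hc
  have hc0 : 0 < c := by positivity
  have hc2 : c ^ 2 = 4 * n * σ ^ 2 := by
    rw [hc, mul_pow, mul_pow, Real.sq_sqrt (Nat.cast_nonneg n)]; ring
  -- This inequality replaces Cauchy–Schwarz in passing from the second moment to the first; it is
  -- sharp at `D = c`.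
  have h1 : ∀ D : ℝ, D ≤ (1 / (2 * c)) * D ^ 2 + c / 2 := by
    intro D
    have : (1 / (2 * c)) * D ^ 2 + c / 2 - D = (D - c) ^ 2 / (2 * c) := by field_simp; ring
    have h2 : 0 ≤ (D - c) ^ 2 / (2 * c) := by positivity
    linarith
  refine (expect_mono _ fun ω => h1 _).trans ?_
  rw [expect_add, expect_const_mul, expect_const]
  have h2 : (1 / (2 * c)) * expect (indepPMF p)
      (fun ω => maxPartial n (fun i => z i (ω i)) 0 0 ^ 2) ≤ (1 / (2 * c)) * c ^ 2 := by
    refine mul_le_mul_of_nonneg_left ?_ (by positivity)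
    rw [hc2]; simpa using h
  have h3 : (1 / (2 * c)) * c ^ 2 = c / 2 := by field_simp
  linarith

end Maximal

/-! Geometric ergodicity of aperiodic unichains -/

section Ergodic

variable {S : Type*} [Fintype S] [DecidableEq S]

/-- `Q` has nonnegative entries and unit row sums. -/
structure IsStochastic (Q : Matrix S S ℝ) : Prop where
  nonneg : ∀ i j, 0 ≤ Q i j
  row_sum : ∀ i, ∑ j, Q i j = 1

omit [DecidableEq S] in
theorem IsStochastic.mul {Q R : Matrix S S ℝ} (hQ : IsStochastic Q) (hR : IsStochastic R) :
    IsStochastic (Q * R) where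
  nonneg i j := by
    rw [Matrix.mul_apply]
    exact Finset.sum_nonneg fun k _ => mul_nonneg (hQ.nonneg _ _) (hR.nonneg _ _)
  row_sum i := by
    simp only [Matrix.mul_apply]
    rw [Finset.sum_comm]
    simp [← Finset.mul_sum, hR.row_sum, hQ.row_sum]

theorem IsStochastic.pow {Q : Matrix S S ℝ} (hQ : IsStochastic Q) (n : ℕ) :
    IsStochastic (Q ^ n) := by
  induction n with
  | zero =>
    refine ⟨fun i j => ?_, fun i => ?_⟩
    · rw [pow_zero, Matrix.one_apply]; split_ifs <;> norm_num
    · simp [Matrix.one_apply]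
  | succ n ih => rw [pow_succ]; exact ih.mul hQ

theorem IsStochastic.pow_add_pos {Q : Matrix S S ℝ} (hQ : IsStochastic Q) {m n : ℕ} {i j k : S}
    (h1 : 0 < (Q ^ m) i j) (h2 : 0 < (Q ^ n) j k) : 0 < (Q ^ (m + n)) i k := by
  rw [pow_add, Matrix.mul_apply]
  refine Finset.sum_pos' (fun l _ => mul_nonneg ((hQ.pow m).nonneg _ _) ((hQ.pow n).nonneg _ _))
    ⟨j, Finset.mem_univ _, mul_pos h1 h2⟩

theorem IsStochastic.accessible_trans {Q : Matrix S S ℝ} (hQ : IsStochastic Q) {i j k : S}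
    (h1 : Accessible Q i j) (h2 : Accessible Q j k) : Accessible Q i k := by
  obtain ⟨m, hm⟩ := h1
  obtain ⟨n, hn⟩ := h2
  exact ⟨m + n, hQ.pow_add_pos hm hn⟩

theorem accessible_refl (Q : Matrix S S ℝ) (i : S) : Accessible Q i i := ⟨0, by simp⟩

/-- Among the states accessible from `s`, one whose own accessible set has minimal cardinality is
recurrent: moving on from it cannot shrink that set. -/
theorem IsStochastic.exists_accessible_recurrent {Q : Matrix S S ℝ} (hQ : IsStochastic Q) (s : S) :
    ∃ s', Accessible Q s s' ∧ IsRecurrent Q s' := by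
  classical
  obtain ⟨s', hs', hmin⟩ := Finset.exists_min_image
    (Finset.univ.filter fun s' => Accessible Q s s')
    (fun s' => (Finset.univ.filter fun t => Accessible Q s' t).card)
    ⟨s, by simp [accessible_refl]⟩
  simp only [Finset.mem_filter, Finset.mem_univ, true_and] at hs' hmin
  refine ⟨s', hs', fun t ht => ?_⟩
  have hsub : (Finset.univ.filter fun u => Accessible Q t u) ⊆
      Finset.univ.filter fun u => Accessible Q s' u := fun u hu => by
    simp only [Finset.mem_filter, Finset.mem_univ, true_and] at hu ⊢
    exact hQ.accessible_trans ht hu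
  have heq := Finset.eq_of_subset_of_card_le hsub (hmin t (hQ.accessible_trans hs' ht))
  have : s' ∈ Finset.univ.filter fun u => Accessible Q t u := by
    rw [heq]; simp [accessible_refl]
  simpa using this

/-- Doeblin's condition holds for a power of an aperiodic unichain. -/
theorem IsAperiodicUnichain.exists_doeblin {Q : Matrix S S ℝ} (hQ : IsStochastic Q)
    (h : IsAperiodicUnichain Q) :
    ∃ (n : ℕ) (s₀ : S) (ε : ℝ), 0 < ε ∧ ∀ s, ε ≤ (Q ^ n) s s₀ := by
  obtain ⟨s₀, hs₀⟩ := h.exists_recurrent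
  have hacc : ∀ s, Accessible Q s s₀ := fun s => by
    obtain ⟨s', h1, h2⟩ := hQ.exists_accessible_recurrent s
    exact hQ.accessible_trans h1 (h.single_class _ _ h2 hs₀)
  choose k hk using hacc
  let R : Set ℕ := {n | 0 < n ∧ 0 < (Q ^ n) s₀ s₀}
  have hgcd : Nat.setGcd R = 1 := h.aperiodic s₀ hs₀ _ fun n hn hp =>
    Nat.setGcd_dvd_of_mem ⟨hn, hp⟩
  -- The additive semigroup generated by return times of gcd one contains all large integers.
  obtain ⟨n₁, hn₁⟩ := Nat.exists_mem_closure_of_ge R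
  have hret : ∀ m ≥ n₁, 0 < (Q ^ m) s₀ s₀ := fun m hm => by
    have := hn₁ m hm (by rw [hgcd]; exact one_dvd _)
    clear hm
    induction this using AddSubmonoid.closure_induction with
    | mem x hx => exact hx.2
    | zero => simp
    | add x y _ _ hx hy => exact hQ.pow_add_pos hx hy
  -- One time for all starting states: after `k s` steps to reach `s₀`, at least `n₁` steps are left
  -- for a return.
  let n := n₁ + ∑ s, k s
  have hpos : ∀ s, 0 < (Q ^ n) s s₀ := fun s => by
    have hle : k s ≤ ∑ s, k s := Finset.single_le_sum (fun _ _ => Nat.zero_le _) (Finset.mem_univ s)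
    have : n = k s + (n - k s) := by omega
    rw [this]
    exact hQ.pow_add_pos (hk s) (hret _ (by omega))
  obtain ⟨i, hi⟩ := @Finite.exists_min S ℝ _ ⟨s₀⟩ _ fun s => (Q ^ n) s s₀
  exact ⟨n, s₀, _, hpos i, hi⟩

variable {Q : Matrix S S ℝ} {μ : S → ℝ}

/-- A zero-sum row vector shrinks under a Doeblin chain. -/
theorem sum_abs_vecMul_le {R : Matrix S S ℝ} (hR : IsStochastic R) {s₀ : S} {ε : ℝ}
    (hε : ∀ s, ε ≤ R s s₀) (v : S → ℝ) (hv : ∑ s, v s = 0) :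
    ∑ s, |(Matrix.vecMul v R) s| ≤ (1 - ε) * ∑ s, |v s| := by
  -- Removing the common mass `ε` from column `s₀` does not change the action on zero-sum vectors,
  -- and it lowers the row sums to `1 - ε`.
  let R' : Matrix S S ℝ := fun i j => R i j - if j = s₀ then ε else 0
  have hR' : ∀ i j, 0 ≤ R' i j := fun i j => by
    by_cases hj : j = s₀
    · subst hj; simpa [R'] using hε i
    · simpa [R', hj] using hR.nonneg i j
  have hR'1 : ∀ i, ∑ j, R' i j = 1 - ε := fun i => by
    simp [R', Finset.sum_sub_distrib, hR.row_sum]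
  have heq : Matrix.vecMul v R = Matrix.vecMul v R' := by
    ext j
    simp only [Matrix.vecMul, dotProduct, R', mul_sub, Finset.sum_sub_distrib]
    rw [← Finset.sum_mul, hv]; simp
  rw [heq]
  calc ∑ j, |(Matrix.vecMul v R') j| ≤ ∑ j, ∑ i, |v i| * R' i j := by
        refine Finset.sum_le_sum fun j _ => (Finset.abs_sum_le_sum_abs _ _).trans ?_
        exact Finset.sum_le_sum fun i _ => by rw [abs_mul, abs_of_nonneg (hR' i j)]
    _ = (1 - ε) * ∑ s, |v s| := by
        rw [Finset.sum_comm]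
        simp only [← Finset.mul_sum, hR'1]
        rw [← Finset.sum_mul, mul_comm]

theorem IsStationary.vecMul_pow (hμ : IsStationary Q μ) (n : ℕ) : Matrix.vecMul μ (Q ^ n) = μ := by
  induction n with
  | zero => simp
  | succ n ih => rw [pow_succ, ← Matrix.vecMul_vecMul, ih, hμ.2.2]

/-- The difference of two stationary laws is a zero-sum vector that a contracting power of `Q`
fixes. -/
theorem IsAperiodicUnichain.stationary_unique (hQ : IsStochastic Q) (h : IsAperiodicUnichain Q)
    {ν : S → ℝ} (hμ : IsStationary Q μ) (hν : IsStationary Q ν) : ν = μ := by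
  obtain ⟨n, s₀, ε, hε, hn⟩ := h.exists_doeblin hQ
  have h1 := sum_abs_vecMul_le (hQ.pow n) hn (ν - μ) (by simp [hμ.2.1, hν.2.1])
  rw [Matrix.sub_vecMul, hμ.vecMul_pow, hν.vecMul_pow] at h1
  have h0 : 0 ≤ ∑ s, |(ν - μ) s| := Finset.sum_nonneg fun _ _ => abs_nonneg _
  have h2 : ∑ s, |(ν - μ) s| = 0 := by nlinarith
  ext s
  have := (Finset.sum_eq_zero_iff_of_nonneg fun i _ => abs_nonneg _).1 h2 s (Finset.mem_univ _)
  exact sub_eq_zero.1 (abs_eq_zero.1 this)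

omit [DecidableEq S] in
theorem vecMul_constRows (μ v : S → ℝ) : Matrix.vecMul v (constRows μ) = (∑ s, v s) • μ := by
  ext j
  simp [Matrix.vecMul, dotProduct, constRows, Finset.sum_mul]

omit [DecidableEq S] in
theorem sum_vecMul_sub_constRows (hQ : IsStochastic Q) (hμ : IsStationary Q μ) (v : S → ℝ) :
    ∑ s, Matrix.vecMul v (Q - constRows μ) s = 0 := by
  rw [Matrix.vecMul_sub, vecMul_constRows]
  simp only [Pi.sub_apply, Pi.smul_apply, smul_eq_mul, Finset.sum_sub_distrib, ← Finset.mul_sum,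
    hμ.2.1, Matrix.vecMul, dotProduct]
  rw [Finset.sum_comm]
  simp [← Finset.mul_sum, hQ.row_sum]

omit [DecidableEq S] in
theorem vecMul_sub_constRows_of_sum_eq_zero {v : S → ℝ} (hv : ∑ s, v s = 0) :
    Matrix.vecMul v (Q - constRows μ) = Matrix.vecMul v Q := by
  rw [Matrix.vecMul_sub, vecMul_constRows, hv, zero_smul, sub_zero]

theorem vecMul_sub_constRows_pow (hQ : IsStochastic Q) (hμ : IsStationary Q μ) {v : S → ℝ}
    (hv : ∑ s, v s = 0) (n : ℕ) :
    Matrix.vecMul v ((Q - constRows μ) ^ n) = Matrix.vecMul v (Q ^ n) ∧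
      ∑ s, Matrix.vecMul v ((Q - constRows μ) ^ n) s = 0 := by
  induction n with
  | zero => simpa using hv
  | succ n ih =>
    rw [pow_succ, ← Matrix.vecMul_vecMul]
    refine ⟨?_, sum_vecMul_sub_constRows hQ hμ _⟩
    rw [vecMul_sub_constRows_of_sum_eq_zero ih.2, ih.1, pow_succ, ← Matrix.vecMul_vecMul]

/-- A nonnegative sequence that contracts along an arithmetic progression is summable. -/
theorem summable_of_shift_le {a : ℕ → ℝ} (ha : ∀ k, 0 ≤ a k) {n : ℕ} {r : ℝ} (hr : r < 1)
    (h : ∀ k, a (n + k) ≤ r * a k) : Summable a := by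
  refine summable_of_sum_range_le (c := (∑ k ∈ Finset.range n, a k) / (1 - r)) ha fun K => ?_
  -- With `A K` the sum of the first `K` terms, `A K ≤ A (n + K) ≤ A n + r * A K`, which bounds `A
  -- K`.
  have h1 : ∑ k ∈ Finset.range K, a k ≤ ∑ k ∈ Finset.range (n + K), a k :=
    Finset.sum_le_sum_of_subset_of_nonneg (Finset.range_mono (by omega)) fun _ _ _ => ha _
  have h2 : ∑ k ∈ Finset.range K, a (n + k) ≤ r * ∑ k ∈ Finset.range K, a k := by
    rw [Finset.mul_sum]; exact Finset.sum_le_sum fun k _ => h k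
  rw [Finset.sum_range_add] at h1
  rw [le_div_iff₀ (by linarith)]
  nlinarith

theorem IsAperiodicUnichain.summable_pow (hQ : IsStochastic Q) (h : IsAperiodicUnichain Q)
    (hμ : IsStationary Q μ) :
    Summable fun k : ℕ => ∑ i, ∑ j, |((Q - constRows μ) ^ k) i j| := by
  obtain ⟨n, s₀, ε, hε, hn⟩ := h.exists_doeblin hQ
  have hε1 : ε ≤ 1 := (hn s₀).trans <| by
    rw [← (hQ.pow n).row_sum s₀]
    exact Finset.single_le_sum (fun j _ => (hQ.pow n).nonneg s₀ j) (Finset.mem_univ s₀)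
  -- The power zero is dropped because the rows of the identity do not sum to zero, while those of
  -- every later power do.
  rw [← summable_nat_add_iff 1]
  refine summable_of_shift_le (n := n) (r := 1 - ε)
    (fun k => Finset.sum_nonneg fun _ _ => Finset.sum_nonneg fun _ _ => abs_nonneg _)
    (by linarith) fun k => ?_
  rw [Finset.mul_sum]
  refine Finset.sum_le_sum fun i _ => ?_
  have hrow : ∀ m, ((Q - constRows μ) ^ m) i = Matrix.vecMul (Pi.single i 1)
      ((Q - constRows μ) ^ m) := fun m => by ext; simp
  have hsum : ∑ s, ((Q - constRows μ) ^ (k + 1)) i s = 0 := by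
    rw [hrow, pow_succ, ← Matrix.vecMul_vecMul]
    exact sum_vecMul_sub_constRows hQ hμ _
  have heq : ((Q - constRows μ) ^ (n + k + 1)) i =
      Matrix.vecMul (((Q - constRows μ) ^ (k + 1)) i) (Q ^ n) := by
    rw [← (vecMul_sub_constRows_pow hQ hμ hsum n).1, hrow (k + 1), Matrix.vecMul_vecMul, ← pow_add,
      hrow]
    congr 2
    omega
  rw [heq]
  exact sum_abs_vecMul_le (hQ.pow n) hn _ hsum

end Ergodic

/-! The weight matrix -/

section Weight

variable {S : Type*} [Fintype S] [DecidableEq S] {Q : Matrix S S ℝ} {μ : S → ℝ}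

theorem abs_pow_apply_le (B : Matrix S S ℝ) (k : ℕ) (i j : S) :
    |(B ^ k) i j| ≤ ∑ i, ∑ j, |(B ^ k) i j| :=
  (Finset.single_le_sum (f := fun j => |(B ^ k) i j|) (fun _ _ => abs_nonneg _)
      (Finset.mem_univ j)).trans
    (Finset.single_le_sum (f := fun i => ∑ j, |(B ^ k) i j|)
      (fun _ _ => Finset.sum_nonneg fun _ _ => abs_nonneg _) (Finset.mem_univ i))

theorem IsAperiodicUnichain.exists_isWeightMatrix (hQ : IsStochastic Q)
    (h : IsAperiodicUnichain Q) (hμ : IsStationary Q μ) : ∃ W, IsWeightMatrix Q μ W := by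
  have hs := h.summable_pow hQ hμ
  set B := Q - constRows μ with hB
  suffices Summable fun k : ℕ => B ^ k * (Q.transpose - (constRows μ).transpose) ^ k from
    ⟨_, this.hasSum⟩
  rw [← Matrix.transpose_sub, ← hB]
  refine Pi.summable.2 fun i => Pi.summable.2 fun j => ?_
  simp only [← Matrix.transpose_pow, Matrix.mul_apply, Matrix.transpose_apply]
  refine summable_sum fun l _ => ?_
  have h1 : Summable fun k => |(B ^ k) i l| :=
    hs.of_nonneg_of_le (fun _ => abs_nonneg _) fun k => abs_pow_apply_le B k i l
  have h2 : Summable fun k => |(B ^ k) j l| :=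
    hs.of_nonneg_of_le (fun _ => abs_nonneg _) fun k => abs_pow_apply_le B k j l
  refine (h1.mul_right (∑' k, |(B ^ k) j l|)).of_norm_bounded fun k => ?_
  rw [Real.norm_eq_abs, abs_mul]
  exact mul_le_mul_of_nonneg_left (h2.le_tsum k fun _ _ => abs_nonneg _) (abs_nonneg _)

/-- The quadratic form of the weight matrix. -/
theorem IsWeightMatrix.hasSum_dotProduct {W : Matrix S S ℝ} (hW : IsWeightMatrix Q μ W)
    (v : S → ℝ) :
    HasSum (fun k : ℕ => Matrix.vecMul v ((Q - constRows μ) ^ k) ⬝ᵥ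
      Matrix.vecMul v ((Q - constRows μ) ^ k)) (v ⬝ᵥ W.mulVec v) := by
  unfold IsWeightMatrix at hW
  rw [← Matrix.transpose_sub] at hW
  have hW' := fun i j => Pi.hasSum.1 (Pi.hasSum.1 hW i) j
  have h : HasSum (fun k : ℕ => ∑ i, v i * ∑ j,
      ((Q - constRows μ) ^ k * (Q - constRows μ).transpose ^ k) i j * v j) (v ⬝ᵥ W.mulVec v) :=
    hasSum_sum fun i _ => (hasSum_sum fun j _ => (hW' i j).mul_right (v j)).mul_left (v i)
  refine h.congr_fun fun k => ?_
  change _ = v ⬝ᵥ ((Q - constRows μ) ^ k * (Q - constRows μ).transpose ^ k).mulVec v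
  rw [← Matrix.transpose_pow, ← Matrix.mulVec_mulVec, Matrix.mulVec_transpose,
    Matrix.dotProduct_mulVec]

theorem IsWeightMatrix.isHermitian {W : Matrix S S ℝ} (hW : IsWeightMatrix Q μ W) :
    W.IsHermitian := by
  unfold IsWeightMatrix at hW
  rw [← Matrix.transpose_sub] at hW
  ext i j
  have h1 := Pi.hasSum.1 (Pi.hasSum.1 hW i) j
  have h2 := Pi.hasSum.1 (Pi.hasSum.1 hW j) i
  simp only [Matrix.conjTranspose_apply, star_trivial]
  refine h2.unique (h1.congr_fun fun k => ?_)
  simp only [← Matrix.transpose_pow, Matrix.mul_apply, Matrix.transpose_apply, mul_comm]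

theorem exists_isMaxEigenvalue [Nonempty S] {W : Matrix S S ℝ} (hW : W.IsHermitian) :
    ∃ l, IsMaxEigenvalue W l := by
  have hset : {x : ℝ | Module.End.HasEigenvalue (Matrix.toLin' W) x} =
      Set.range hW.eigenvalues := by
    ext x
    rw [Set.mem_ofPred_eq, Module.End.hasEigenvalue_iff_mem_spectrum, Matrix.spectrum_toLin',
      hW.spectrum_real_eq_range_eigenvalues]
  obtain ⟨i, hi⟩ := Finite.exists_max hW.eigenvalues
  refine ⟨hW.eigenvalues i, ?_⟩
  rw [IsMaxEigenvalue, hset]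
  exact ⟨⟨i, rfl⟩, by rintro _ ⟨j, rfl⟩; exact hi j⟩

/-- The spectrum of `l - W` is nonnegative, so this Hermitian matrix is positive semidefinite. -/
theorem IsMaxEigenvalue.dotProduct_le {W : Matrix S S ℝ} {l : ℝ} (hl : IsMaxEigenvalue W l)
    (hW : W.IsHermitian) (v : S → ℝ) : v ⬝ᵥ W.mulVec v ≤ l * (v ⬝ᵥ v) := by
  have hH : (algebraMap ℝ (Matrix S S ℝ) l - W).IsHermitian := by
    refine Matrix.IsHermitian.sub ?_ hW
    rw [Matrix.algebraMap_eq_diagonal]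
    exact Matrix.isHermitian_diagonal _
  have hP : (algebraMap ℝ (Matrix S S ℝ) l - W).PosSemidef := by
    rw [Matrix.posSemidef_iff_isHermitian_and_spectrum_nonneg]
    refine ⟨hH, ?_⟩
    rw [← spectrum.singleton_sub_eq]
    rintro _ ⟨l', hl', x, hx, rfl⟩
    rw [Set.mem_singleton_iff.1 hl']
    have : x ≤ l := hl.2 (by
      rwa [Set.mem_ofPred_eq, Module.End.hasEigenvalue_iff_mem_spectrum, Matrix.spectrum_toLin'])
    simpa using this
  have := hP.dotProduct_mulVec_nonneg v
  rw [Matrix.sub_mulVec, dotProduct_sub, Algebra.algebraMap_eq_smul_one, Matrix.smul_mulVec,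
    Matrix.one_mulVec, dotProduct_smul] at this
  simpa using this

/-- The weighted norm as the Euclidean norm of a linear image: it dominates the Euclidean norm,
is dominated by `√l` times the Euclidean norm, and the chain contracts it. -/
theorem IsWeightMatrix.exists_linearMap [Nonempty S] {W : Matrix S S ℝ}
    (hW : IsWeightMatrix Q μ W) {l : ℝ} (hl : IsMaxEigenvalue W l) :
    1 ≤ l ∧ ∃ L : (S → ℝ) →ₗ[ℝ] EuclideanSpace ℝ S, ∀ v : S → ℝ,
      v ⬝ᵥ v ≤ ‖L v‖ ^ 2 ∧ ‖L v‖ ^ 2 ≤ l * (v ⬝ᵥ v) ∧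
      ‖L (Matrix.vecMul v (Q - constRows μ))‖ ^ 2 ≤ (1 - 1 / l) * ‖L v‖ ^ 2 := by
  have hH := hW.isHermitian
  have hnn : ∀ w : S → ℝ, 0 ≤ w ⬝ᵥ w := fun w =>
    Finset.sum_nonneg fun i _ => mul_self_nonneg _
  have hge : ∀ v, v ⬝ᵥ v ≤ v ⬝ᵥ W.mulVec v := fun v => by
    simpa using le_hasSum (hW.hasSum_dotProduct v) 0 fun k _ => hnn _
  have hle := hl.dotProduct_le hH
  -- The quadratic form is `∑ₖ ‖v Bᵏ‖²` with `B = Q - Ξ`. Applying `B` to `v` shifts the series and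
  -- loses exactly its first term `‖v‖²`, which is at least a fraction `1 / l` of the whole.
  have hstep : ∀ v, (Matrix.vecMul v (Q - constRows μ)) ⬝ᵥ
      W.mulVec (Matrix.vecMul v (Q - constRows μ)) = v ⬝ᵥ W.mulVec v - v ⬝ᵥ v := fun v => by
    have h1 := hW.hasSum_dotProduct (Matrix.vecMul v (Q - constRows μ))
    have h2 := (hasSum_nat_add_iff' 1).2 (hW.hasSum_dotProduct v)
    simp only [Matrix.vecMul_vecMul, ← pow_succ'] at h1
    simpa using h1.unique h2
  have hl1 : 1 ≤ l := by
    obtain ⟨s⟩ := ‹Nonempty S›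
    have := (hge (Pi.single s 1)).trans (hle (Pi.single s 1))
    simpa using this
  have hP : W.PosSemidef := Matrix.PosSemidef.of_dotProduct_mulVec_nonneg hH fun v => by
    simpa using (hnn v).trans (hge v)
  obtain ⟨C, hC⟩ : ∃ C : Matrix S S ℝ, W = C.transpose * C := by
    open scoped MatrixOrder Matrix.Norms.L2Operator in
    obtain ⟨C, hC⟩ := CStarAlgebra.nonneg_iff_eq_star_mul_self.mp hP.nonneg
    exact ⟨C, by rw [hC, Matrix.star_eq_conjTranspose, Matrix.conjTranspose_eq_transpose_of_trivial]⟩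
  let L : (S → ℝ) →ₗ[ℝ] EuclideanSpace ℝ S :=
    (WithLp.linearEquiv 2 ℝ (S → ℝ)).symm.toLinearMap ∘ₗ Matrix.mulVecLin C
  have hL : ∀ v, ‖L v‖ ^ 2 = v ⬝ᵥ W.mulVec v := fun v => by
    rw [EuclideanSpace.norm_sq_eq, hC, ← Matrix.mulVec_mulVec, Matrix.dotProduct_mulVec,
      Matrix.vecMul_transpose]
    simp [L, dotProduct, sq]
  refine ⟨hl1, L, fun v => ⟨?_, ?_, ?_⟩⟩
  · rw [hL]; exact hge v
  · rw [hL]; exact hle v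
  · rw [hL, hL, hstep]
    have h0 : 0 < l := by linarith
    have : (1 / l) * (v ⬝ᵥ W.mulVec v) ≤ v ⬝ᵥ v := by
      rw [one_div, inv_mul_le_iff₀ h0]; exact hle v
    linarith

end Weight

/-! Cesàro limits of finite Markov chains -/

section Cesaro

variable {X : Type*} [Fintype X]

/-- The transition operator of a Markov kernel, acting on functions. -/
def stepOp (κ : X → PMF X) : Module.End ℝ (X → ℝ) where
  toFun g x := expect (κ x) g
  map_add' f g := by ext x; exact expect_add _ _ _
  map_smul' c f := by ext x; exact expect_const_mul _ _ _

theorem stepOp_apply (κ : X → PMF X) (g : X → ℝ) (x : X) : stepOp κ g x = expect (κ x) g := rfl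

theorem stepOp_pow_mono (κ : X → PMF X) (n : ℕ) {f g : X → ℝ} (h : ∀ x, f x ≤ g x) (x : X) :
    (stepOp κ ^ n) f x ≤ (stepOp κ ^ n) g x := by
  induction n generalizing x with
  | zero => exact h x
  | succ n ih =>
    simp only [pow_succ', Module.End.mul_apply, stepOp_apply]
    exact expect_mono _ ih

theorem stepOp_pow_const (κ : X → PMF X) (n : ℕ) (c : ℝ) :
    (stepOp κ ^ n) (fun _ => c) = fun _ => c := by
  induction n with
  | zero => rfl
  | succ n ih =>
    ext x
    rw [pow_succ', Module.End.mul_apply, ih, stepOp_apply, expect_const]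

theorem norm_stepOp_pow_le (κ : X → PMF X) (n : ℕ) (f : X → ℝ) : ‖(stepOp κ ^ n) f‖ ≤ ‖f‖ := by
  rw [pi_norm_le_iff_of_nonneg (norm_nonneg f)]
  intro x
  have hle : ∀ y, |f y| ≤ ‖f‖ := fun y => norm_le_pi_norm f y
  rw [Real.norm_eq_abs, abs_le]
  constructor
  · refine le_trans ?_ (stepOp_pow_mono κ n (f := fun _ => -‖f‖) (fun y => (abs_le.1 (hle y)).1) x)
    rw [stepOp_pow_const]
  · refine (stepOp_pow_mono κ n (g := fun _ => ‖f‖) (fun y => (abs_le.1 (hle y)).2) x).trans ?_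
    rw [stepOp_pow_const]

/-- Mean ergodic theorem in finite dimension, without any irreducibility or aperiodicity. With `A =
κ - 1`, the space is the direct sum of `ker A` and `range A`; averages are constant on the kernel
and telescope to `O(1 / T)` on the range. -/
theorem exists_tendsto_cesaro (κ : X → PMF X) (g : X → ℝ) (x : X) :
    ∃ R, Tendsto (fun T : ℕ => (1 / (T : ℝ)) * ∑ t ∈ Finset.range T, (stepOp κ ^ t) g x)
      atTop (𝓝 R) := by
  set A := stepOp κ - 1 with hA
  have hstep : ∀ w (n : ℕ), (stepOp κ ^ n) (A w) = (stepOp κ ^ (n + 1)) w - (stepOp κ ^ n) w := by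
    intro w n
    simp [hA, pow_succ]
  have htel : ∀ w (n : ℕ), ∑ t ∈ Finset.range n, (stepOp κ ^ t) (A w) = (stepOp κ ^ n) w - w := by
    intro w n
    simp only [hstep]
    exact (Finset.sum_range_sub (fun t => (stepOp κ ^ t) w) n).trans (by simp)
  have hfix : ∀ u, A u = 0 → ∀ n : ℕ, (stepOp κ ^ n) u = u := by
    intro u hu n
    induction n with
    | zero => rfl
    | succ n ih =>
      have := hstep u n
      rw [hu, map_zero] at this
      rw [ih] at this
      exact sub_eq_zero.1 this.symm
  -- If `A w` is fixed by `κ`, then `n • A w = κⁿ w - w` stays bounded in `n`, so `A w = 0`.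
  have hdisj : Disjoint (LinearMap.ker A) (LinearMap.range A) := by
    rw [Submodule.disjoint_def]
    rintro _ hu ⟨w, rfl⟩
    rw [LinearMap.mem_ker] at hu
    have hn : ∀ n : ℕ, n * ‖A w‖ ≤ 2 * ‖w‖ := by
      intro n
      have h1 := htel w n
      simp only [hfix _ hu, Finset.sum_const, Finset.card_range] at h1
      calc n * ‖A w‖ = ‖n • A w‖ := by rw [RCLike.norm_nsmul ℝ, nsmul_eq_mul]
        _ ≤ ‖(stepOp κ ^ n) w‖ + ‖w‖ := by rw [h1]; exact norm_sub_le _ _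
        _ ≤ 2 * ‖w‖ := by linarith [norm_stepOp_pow_le κ n w]
    by_contra hne
    obtain ⟨n, hn'⟩ := exists_nat_gt (2 * ‖w‖ / ‖A w‖)
    rw [div_lt_iff₀ (norm_pos_iff.2 hne)] at hn'
    linarith [hn n]
  have htop : LinearMap.ker A ⊔ LinearMap.range A = ⊤ := by
    refine Submodule.eq_top_of_disjoint _ _ ?_ hdisj
    rw [add_comm, LinearMap.finrank_range_add_finrank_ker]
  obtain ⟨u, hu, v, ⟨w, rfl⟩, rfl⟩ := Submodule.mem_sup.1 (htop ▸ Submodule.mem_top : g ∈ _)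
  rw [LinearMap.mem_ker] at hu
  refine ⟨u x, ?_⟩
  have heq : ∀ T : ℕ, 0 < T → (1 / (T : ℝ)) * ∑ t ∈ Finset.range T, (stepOp κ ^ t) (u + A w) x =
      u x + (1 / (T : ℝ)) * (((stepOp κ ^ T) w) x - w x) := by
    intro T hT
    have h1 := congrFun (htel w T) x
    simp only [Finset.sum_apply, Pi.sub_apply] at h1
    simp only [map_add, Pi.add_apply, hfix u hu, Finset.sum_add_distrib, h1, Finset.sum_const,
      Finset.card_range, nsmul_eq_mul]
    have : (T : ℝ) ≠ 0 := by positivity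
    field_simp
  have hlim : Tendsto (fun T : ℕ => u x + (1 / (T : ℝ)) * (((stepOp κ ^ T) w) x - w x)) atTop
      (𝓝 (u x + 0)) := by
    refine tendsto_const_nhds.add ?_
    refine squeeze_zero_norm (a := fun T : ℕ => (1 / (T : ℝ)) * (2 * ‖w‖)) (fun T => ?_) ?_
    · rw [norm_mul, Real.norm_of_nonneg (by positivity)]
      refine mul_le_mul_of_nonneg_left ?_ (by positivity)
      have h1 := (norm_le_pi_norm ((stepOp κ ^ T) w) x).trans (norm_stepOp_pow_le κ T w)
      have h2 := norm_le_pi_norm w x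
      exact (norm_sub_le _ _).trans (by linarith)
    · simpa using tendsto_one_div_atTop_nhds_zero_nat.mul_const (2 * ‖w‖)
  rw [add_zero] at hlim
  refine hlim.congr' ?_
  filter_upwards [eventually_gt_atTop 0] with T hT using (heq T hT).symm

end Cesaro

/-! The single-armed policy of a feasible point -/

section SingleArm

variable {S : Type*} [Fintype S] {M : MDP S} {α : ℝ} {y : S → Fin 2 → ℝ}

omit [Fintype S] in
theorem MDP.P_nonneg (M : MDP S) (s : S) (a : Fin 2) (s' : S) : 0 ≤ M.P s a s' :=
  ENNReal.toReal_nonneg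

theorem MDP.sum_P (M : MDP S) (s : S) (a : Fin 2) : ∑ s', M.P s a s' = 1 := sum_toReal _

theorem IsLPFeasible.singleArmProb_nonneg (hy : IsLPFeasible M α y) (s : S) (a : Fin 2) :
    0 ≤ singleArmProb y s a := by
  have h := hy.nonneg s
  have h0 := h 0
  have h1 := h 1
  have ha := h a
  unfold singleArmProb
  split_ifs <;> positivity

omit [Fintype S] in
theorem sum_singleArmProb (y : S → Fin 2 → ℝ) (s : S) :
    ∑ a, singleArmProb y s a = 1 := by
  rw [Fin.sum_univ_two]
  unfold singleArmProb
  split_ifs with h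
  · rw [← add_div, div_self h.ne']
  · norm_num

theorem IsLPFeasible.idealAction_toReal (hy : IsLPFeasible M α y) (s : S) (a : Fin 2) :
    (idealAction hy s a).toReal = singleArmProb y s a := by
  simp [idealAction, ENNReal.toReal_ofReal (hy.singleArmProb_nonneg s a)]

theorem IsLPFeasible.sum_mul_singleArmProb (hy : IsLPFeasible M α y) (s : S) (a : Fin 2) :
    (∑ a, y s a) * singleArmProb y s a = y s a := by
  have h := hy.nonneg s
  rw [Fin.sum_univ_two]
  unfold singleArmProb
  split_ifs with hp
  · exact mul_div_cancel₀ _ hp.ne'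
  · have h0 := h 0
    have h1 := h 1
    have : y s a = 0 := by fin_cases a <;> simp <;> linarith
    rw [this, mul_eq_zero]
    left
    linarith

theorem IsLPFeasible.isStochastic (hy : IsLPFeasible M α y) :
    IsStochastic (singleArmMatrix M y) where
  nonneg s s' := by
    simp only [singleArmMatrix, Matrix.of_apply]
    exact Finset.sum_nonneg fun a _ => mul_nonneg (hy.singleArmProb_nonneg s a) (M.P_nonneg s a s')
  row_sum s := by
    simp only [singleArmMatrix, Matrix.of_apply]
    rw [Finset.sum_comm]
    simp only [← Finset.mul_sum, M.sum_P, mul_one]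
    exact sum_singleArmProb y s

theorem IsLPFeasible.isStationary (hy : IsLPFeasible M α y) :
    IsStationary (singleArmMatrix M y) fun s => ∑ a, y s a := by
  refine ⟨fun s => Finset.sum_nonneg fun a _ => hy.nonneg s a, hy.total, ?_⟩
  ext s
  rw [← hy.balance s]
  simp only [Matrix.vecMul, dotProduct, singleArmMatrix, Matrix.of_apply]
  refine Finset.sum_congr rfl fun s' _ => ?_
  rw [Finset.mul_sum]
  exact Finset.sum_congr rfl fun a _ => by rw [← mul_assoc, hy.sum_mul_singleArmProb]

theorem MDP.abs_reward_le (M : MDP S) (s : S) (a : Fin 2) : |M.reward s a| ≤ M.rmax :=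
  le_ciSup (f := fun x : S × Fin 2 => |M.reward x.1 x.2|) (Set.finite_range _).bddAbove (s, a)

end SingleArm

/-! The linear program bounds the optimal reward -/

section UpperBound

variable {S : Type*} [Fintype S] (M : MDP S) {N : ℕ}

theorem expect_stateActionLaw (π : Policy S N) (s₀ : Fin N → S) (t : ℕ)
    (f : (Fin N → S) × Actions N → ℝ) :
    expect (stateActionLaw M π s₀ t) f =
      expect (historyLaw M π s₀ t) fun h => expect (π t h) fun a => f (h.2, a) := by
  rw [stateActionLaw, expect_bind]
  simp only [expect_map]

theorem expect_historyLaw_succ (π : Policy S N) (s₀ : Fin N → S) (t : ℕ)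
    (g : (Fin N → S) → ℝ) :
    expect (historyLaw M π s₀ (t + 1)) (fun h => g h.2) =
      expect (stateActionLaw M π s₀ t) fun x => expect (nextStates M x.1 x.2) g := by
  rw [expect_stateActionLaw, historyLaw, expect_bind]
  simp only [expect_bind, expect_map]

/-- The average over the arms of the expectation of `f` at the state-action pair at time `t`. -/
def armAverage (π : Policy S N) (s₀ : Fin N → S) (t : ℕ) (f : S → Fin 2 → ℝ) : ℝ :=
  (1 / (N : ℝ)) * ∑ i, expect (stateActionLaw M π s₀ t) fun x => f (x.1 i) (x.2 i)

variable (π : Policy S N) (s₀ : Fin N → S)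

theorem armAverage_sum {ι : Type*} (I : Finset ι) (t : ℕ) (f : ι → S → Fin 2 → ℝ) :
    armAverage M π s₀ t (fun s a => ∑ j ∈ I, f j s a) = ∑ j ∈ I, armAverage M π s₀ t (f j) := by
  unfold armAverage
  simp only [expect_sum]
  rw [← Finset.mul_sum, Finset.sum_comm]

theorem armAverage_const_mul (t : ℕ) (c : ℝ) (f : S → Fin 2 → ℝ) :
    armAverage M π s₀ t (fun s a => c * f s a) = c * armAverage M π s₀ t f := by
  unfold armAverage
  simp only [expect_const_mul]
  rw [← Finset.mul_sum]
  ring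

theorem armAverage_mono (t : ℕ) {f g : S → Fin 2 → ℝ} (h : ∀ s a, f s a ≤ g s a) :
    armAverage M π s₀ t f ≤ armAverage M π s₀ t g :=
  mul_le_mul_of_nonneg_left
    (Finset.sum_le_sum fun i _ => expect_mono _ fun x => h (x.1 i) (x.2 i)) (by positivity)

theorem armAverage_const (hN : 0 < N) (t : ℕ) (c : ℝ) :
    armAverage M π s₀ t (fun _ _ => c) = c := by
  have : (N : ℝ) ≠ 0 := by positivity
  simp only [armAverage, expect_const, Finset.sum_const, Finset.card_univ, Fintype.card_fin,
    nsmul_eq_mul]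
  field_simp

theorem armAverage_succ (t : ℕ) (f : S → ℝ) :
    armAverage M π s₀ (t + 1) (fun s _ => f s) =
      armAverage M π s₀ t fun s a => ∑ s', M.P s a s' * f s' := by
  unfold armAverage
  congr 1
  refine Finset.sum_congr rfl fun i _ => ?_
  rw [expect_stateActionLaw]
  simp only [expect_const]
  rw [expect_historyLaw_succ M π s₀ t fun s => f (s i)]
  simp only [nextStates, expect_indepPMF_apply]
  rfl

theorem MeetsBudget.armAverage_eq {α : ℝ} (hN : 0 < N) (h : MeetsBudget M α π s₀) (t : ℕ) :
    armAverage M π s₀ t (fun _ a => ((a : ℕ) : ℝ)) = α := by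
  have : (N : ℝ) ≠ 0 := by positivity
  unfold armAverage
  rw [← expect_sum, expect_congr_support _ (g := fun _ => α * N), expect_const]
  · field_simp
  · intro x hx
    rw [← h t x hx]
    simp [pulls]

variable [DecidableEq S]

/-- The probability that a uniformly chosen arm is in state `s` with action `a` at time `t`. -/
def occupancy (t : ℕ) (s : S) (a : Fin 2) : ℝ :=
  armAverage M π s₀ t fun s' a' => if s' = s ∧ a' = a then 1 else 0

theorem sum_mul_occupancy (t : ℕ) (f : S → Fin 2 → ℝ) :
    ∑ s, ∑ a, f s a * occupancy M π s₀ t s a = armAverage M π s₀ t f := by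
  have h : f = fun s' a' => ∑ s, ∑ a, f s a * (if s' = s ∧ a' = a then 1 else 0) := by
    ext s' a'
    rw [Finset.sum_eq_single s', Finset.sum_eq_single a']
    · simp
    · intro a _ ha; simp [ha.symm]
    · simp
    · intro s _ hs
      exact Finset.sum_eq_zero fun a _ => by simp [hs.symm]
    · simp
  conv_rhs => rw [h]
  simp only [armAverage_sum, armAverage_const_mul]
  rfl

theorem occupancy_mem_Icc (hN : 0 < N) (t : ℕ) (s : S) (a : Fin 2) :
    occupancy M π s₀ t s a ∈ Set.Icc (0 : ℝ) 1 := by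
  constructor
  · rw [← armAverage_const M π s₀ hN t 0]
    exact armAverage_mono M π s₀ t fun s' a' => by split_ifs <;> norm_num
  · rw [← armAverage_const M π s₀ hN t 1]
    exact armAverage_mono M π s₀ t fun s' a' => by split_ifs <;> norm_num

/-- The occupancy averaged over the first `T` steps. -/
def meanOccupancy (T : ℕ) (s : S) (a : Fin 2) : ℝ :=
  (1 / (T : ℝ)) * ∑ t ∈ Finset.range T, occupancy M π s₀ t s a

theorem sum_mul_meanOccupancy (T : ℕ) (f : S → Fin 2 → ℝ) :
    ∑ s, ∑ a, f s a * meanOccupancy M π s₀ T s a =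
      (1 / (T : ℝ)) * ∑ t ∈ Finset.range T, armAverage M π s₀ t f := by
  simp only [← sum_mul_occupancy, meanOccupancy, Finset.mul_sum]
  rw [Finset.sum_comm (s := Finset.range T)]
  refine Finset.sum_congr rfl fun s _ => ?_
  rw [Finset.sum_comm (s := Finset.range T)]
  exact Finset.sum_congr rfl fun a _ => Finset.sum_congr rfl fun t _ => by ring

theorem meanOccupancy_mem_Icc (hN : 0 < N) (T : ℕ) (s : S) (a : Fin 2) :
    meanOccupancy M π s₀ T s a ∈ Set.Icc (0 : ℝ) 1 := by
  have h := fun t => occupancy_mem_Icc M π s₀ hN t s a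
  have h0 : 0 ≤ ∑ t ∈ Finset.range T, occupancy M π s₀ t s a := Finset.sum_nonneg fun t _ => (h t).1
  have h1 : ∑ t ∈ Finset.range T, occupancy M π s₀ t s a ≤ T :=
    (Finset.sum_le_sum fun t _ => (h t).2).trans (by simp)
  refine ⟨mul_nonneg (by positivity) h0, ?_⟩
  rcases Nat.eq_zero_or_pos T with rfl | hT
  · simp [meanOccupancy]
  · have : (0 : ℝ) < T := by positivity
    rw [meanOccupancy, one_div, inv_mul_le_iff₀ this]
    linarith

theorem avgReward_eq (T : ℕ) :
    avgReward M π s₀ T = ∑ s, ∑ a, M.reward s a * meanOccupancy M π s₀ T s a :=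
  (sum_mul_meanOccupancy M π s₀ T M.reward).symm

theorem mean_const_eq {T : ℕ} (hT : 0 < T) (c : ℝ) :
    (1 / (T : ℝ)) * ∑ _t ∈ Finset.range T, c = c := by
  have : (T : ℝ) ≠ 0 := by positivity
  simp only [Finset.sum_const, Finset.card_range, nsmul_eq_mul]
  field_simp

/-- The mean occupancy asymptotically satisfies the balance equations. -/
theorem tendsto_balance_meanOccupancy (hN : 0 < N) (s : S) :
    Tendsto (fun T => ∑ s', ∑ a, (M.P s' a s - if s' = s then 1 else 0) *
      meanOccupancy M π s₀ T s' a) atTop (𝓝 0) := by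
  set e : S → ℝ := fun s' => if s' = s then 1 else 0 with he
  have hstep : ∀ t, armAverage M π s₀ t (fun s' a => M.P s' a s - e s') =
      armAverage M π s₀ (t + 1) (fun s' _ => e s') - armAverage M π s₀ t (fun s' _ => e s') := by
    intro t
    rw [armAverage_succ]
    simp only [armAverage, expect_sub, Finset.sum_sub_distrib, mul_sub]
    simp [he]
  have hb : ∀ t, armAverage M π s₀ t (fun s' _ => e s') ∈ Set.Icc (0 : ℝ) 1 := by
    intro t
    constructor
    · rw [← armAverage_const M π s₀ hN t 0]
      exact armAverage_mono M π s₀ t fun s' _ => by simp only [he]; split_ifs <;> norm_num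
    · rw [← armAverage_const M π s₀ hN t 1]
      exact armAverage_mono M π s₀ t fun s' _ => by simp only [he]; split_ifs <;> norm_num
  refine squeeze_zero_norm (a := fun T : ℕ => 1 / (T : ℝ)) (fun T => ?_)
    tendsto_one_div_atTop_nhds_zero_nat
  rw [sum_mul_meanOccupancy M π s₀ T fun s' a => M.P s' a s - e s']
  simp only [hstep]
  -- The balance defect telescopes in time to a difference of two numbers in `[0, 1]`.
  rw [Finset.sum_range_sub (fun t => armAverage M π s₀ t fun s' _ => e s'), norm_mul,
    Real.norm_of_nonneg (by positivity : 0 ≤ 1 / (T : ℝ)), Real.norm_eq_abs]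
  refine mul_le_of_le_one_right (by positivity) ?_
  have h1 := hb T
  have h2 := hb 0
  rw [abs_le]
  constructor <;> linarith [h1.1, h1.2, h2.1, h2.2]

variable {M π s₀} {α : ℝ} {y : S → Fin 2 → ℝ}

/-- No policy that meets the budget does better than the linear program. -/
theorem IsLPOptimal.liminfReward_le (hy : IsLPOptimal M α y) (hN : 0 < N)
    (hπ : MeetsBudget M α π s₀) : liminfReward M π s₀ ≤ lpValue M y := by
  have hmem : ∀ T, meanOccupancy M π s₀ T ∈ Set.Icc (0 : S → Fin 2 → ℝ) 1 := fun T =>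
    ⟨fun s a => (meanOccupancy_mem_Icc M π s₀ hN T s a).1,
      fun s a => (meanOccupancy_mem_Icc M π s₀ hN T s a).2⟩
  -- A single limit point suffices: the liminf is at most the limit of the rewards along any
  -- subsequence.
  obtain ⟨z, hz, φ, hφ, hlim⟩ := isCompact_Icc.tendsto_subseq hmem
  have hpair : ∀ f : S → Fin 2 → ℝ,
      Tendsto (fun n => ∑ s, ∑ a, f s a * meanOccupancy M π s₀ (φ n) s a) atTop
        (𝓝 (∑ s, ∑ a, f s a * z s a)) := fun f =>
    tendsto_finsetSum _ fun s _ => tendsto_finsetSum _ fun a _ =>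
      ((tendsto_pi_nhds.1 (tendsto_pi_nhds.1 hlim s) a)).const_mul _
  have hconst : ∀ (f : S → Fin 2 → ℝ) (c : ℝ), (∀ t, armAverage M π s₀ t f = c) →
      ∑ s, ∑ a, f s a * z s a = c := fun f c hc => by
    refine tendsto_nhds_unique (hpair f) (tendsto_const_nhds.congr' ?_)
    filter_upwards [eventually_gt_atTop 0] with n hn
    rw [sum_mul_meanOccupancy]
    simp only [hc]
    rw [mean_const_eq (hn.trans_le (hφ.id_le n))]
  have hfeas : IsLPFeasible M α z := by
    refine ⟨?_, fun s => ?_, ?_, fun s a => hz.1 s a⟩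
    · simpa using hconst _ _ fun t => MeetsBudget.armAverage_eq M π s₀ hN hπ t
    · have := tendsto_nhds_unique (hpair fun s' a => M.P s' a s - if s' = s then 1 else 0)
        ((tendsto_balance_meanOccupancy M π s₀ hN s).comp hφ.tendsto_atTop)
      simp only [sub_mul, Finset.sum_sub_distrib, ite_mul, one_mul, zero_mul] at this
      rw [sub_eq_zero] at this
      simpa [mul_comm, Finset.sum_ite_irrel] using this
    · simpa using hconst _ _ fun t => armAverage_const M π s₀ hN t 1
  have hval : Tendsto (fun n => avgReward M π s₀ (φ n)) atTop (𝓝 (lpValue M z)) := by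
    simp only [avgReward_eq]
    exact hpair M.reward
  have hbdd : IsBoundedUnder (· ≥ ·) atTop fun T => avgReward M π s₀ T := by
    refine isBoundedUnder_of ⟨-∑ s, ∑ a, |M.reward s a|, fun T => ?_⟩
    rw [avgReward_eq]
    simp only [← Finset.sum_neg_distrib]
    refine Finset.sum_le_sum fun s _ => Finset.sum_le_sum fun a _ => ?_
    have h1 := meanOccupancy_mem_Icc M π s₀ hN T s a
    nlinarith [neg_abs_le (M.reward s a), abs_nonneg (M.reward s a), h1.1, h1.2]
  by_contra! hlt
  obtain ⟨c, hc1, hc2⟩ := exists_between hlt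
  have hev := eventually_lt_of_lt_liminf hc2 hbdd
  have := ge_of_tendsto hval ((hφ.tendsto_atTop.eventually hev).mono fun n hn => hn.le)
  linarith [hy.optimal z hfeas]

/-- The policy in the hypothesis serves to make the set under the supremum nonempty. -/
theorem IsLPOptimal.optReward_le (hy : IsLPOptimal M α y) (hN : 0 < N)
    (hπ : MeetsBudget M α π s₀) : optReward M N α s₀ ≤ lpValue M y :=
  csSup_le ⟨_, π, hπ, rfl⟩ (by rintro _ ⟨π', hπ', rfl⟩; exact hy.liminfReward_le hN hπ')

end UpperBound

/-! Prefix sums -/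

section Prefix

variable {N : ℕ}

/-- The sum of `f` over the arms with IDs `1, …, n`. -/
def prefixSum {E : Type*} [AddCommMonoid E] (f : Fin N → E) (n : ℕ) : E := ∑ i with i.val < n, f i

section Monoid

variable {E : Type*} [AddCommMonoid E]

theorem prefixSum_zero (f : Fin N → E) : prefixSum f 0 = 0 := by simp [prefixSum]

theorem prefixSum_succ (f : Fin N → E) {n : ℕ} (hn : n < N) :
    prefixSum f (n + 1) = prefixSum f n + f ⟨n, hn⟩ := by
  have : (Finset.univ.filter fun i : Fin N => i.val < n + 1) =
      insert ⟨n, hn⟩ (Finset.univ.filter fun i : Fin N => i.val < n) := by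
    ext i
    simp only [Finset.mem_filter, Finset.mem_univ, true_and, Finset.mem_insert, Fin.ext_iff]
    omega
  rw [prefixSum, this, Finset.sum_insert (by simp), add_comm, prefixSum]

theorem prefixSum_self (f : Fin N → E) : prefixSum f N = ∑ i, f i := by simp [prefixSum]

theorem prefixSum_add (f g : Fin N → E) (n : ℕ) :
    prefixSum (fun i => f i + g i) n = prefixSum f n + prefixSum g n := Finset.sum_add_distrib

theorem prefixSum_const (c : E) {n : ℕ} (hn : n ≤ N) :
    prefixSum (fun _ : Fin N => c) n = n • c := by
  induction n with
  | zero => simp [prefixSum_zero]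
  | succ n ih => rw [prefixSum_succ _ hn, ih (by omega), succ_nsmul]

theorem prefixSum_congr {f g : Fin N → E} {n : ℕ} (h : ∀ i : Fin N, i.val < n → f i = g i) :
    prefixSum f n = prefixSum g n :=
  Finset.sum_congr rfl fun i hi => h i (Finset.mem_filter.1 hi).2

end Monoid

open Classical in
/-- The number of arms with IDs `1, …, n` in state `x`. -/
def stateCount {S : Type*} (s : Fin N → S) (n : ℕ) (x : S) : ℝ :=
  prefixSum (fun i => if s i = x then (1 : ℝ) else 0) n

/-- Prefix sums of state functions depend linearly on the state counts; in this form the contraction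
and deviation bounds of an embedding apply to them. -/
theorem prefixSum_comp {S E : Type*} [Fintype S] [AddCommGroup E] [Module ℝ E] (s : Fin N → S)
    (f : S → E) (n : ℕ) : prefixSum (fun i => f (s i)) n = ∑ x, stateCount s n x • f x := by
  classical
  simp only [stateCount, prefixSum, Finset.sum_smul, ite_smul, one_smul, zero_smul]
  rw [Finset.sum_comm]
  simp

/-- The prefix counts move in steps of at most one and eventually reach the integer `k`, so they
cannot jump over it. This is where the integrality of `α * N` matters. -/
theorem prefixSum_findGreatest (w : Fin N → ℕ) (hw : ∀ i, w i ≤ 1) {x : ℝ} {k : ℕ} (hx : x = k)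
    (hk : k ≤ ∑ i, w i) [DecidablePred fun n : ℕ => ((prefixSum w n : ℕ) : ℝ) ≤ x] :
    prefixSum w (Nat.findGreatest (fun n => ((prefixSum w n : ℕ) : ℝ) ≤ x) N) = k := by
  set n := Nat.findGreatest (fun n => ((prefixSum w n : ℕ) : ℝ) ≤ x) N with hn
  have h0 : ((prefixSum w n : ℕ) : ℝ) ≤ x :=
    Nat.findGreatest_spec (P := fun n => ((prefixSum w n : ℕ) : ℝ) ≤ x) (Nat.zero_le N)
      (by simp [prefixSum_zero, hx])
  have hle : prefixSum w n ≤ k := by rw [hx] at h0; exact_mod_cast h0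
  refine le_antisymm hle ?_
  rcases (Nat.findGreatest_le N : n ≤ N).lt_or_eq with hlt | heq
  · have h1 := Nat.findGreatest_is_greatest (P := fun n => ((prefixSum w n : ℕ) : ℝ) ≤ x)
      (n := N) (k := n + 1) (by omega) hlt
    rw [hx, not_le, prefixSum_succ w hlt] at h1
    have h2 : k < prefixSum w n + w ⟨n, hlt⟩ := by exact_mod_cast h1
    have := hw ⟨n, hlt⟩
    omega
  · exact (hk.trans_eq (prefixSum_self w).symm).trans_eq (congrArg (prefixSum w) heq.symm)

/-- The rectified actions agree with the ideal actions on a prefix, meet the budget, and the prefix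
is all of the arms up to the deviation of its ideal actions from the budget. -/
theorem idRectify_spec {α : ℝ} (hα0 : 0 < α) (hα1 : α < 1) {k : ℕ} (hk : α * N = k)
    (a : Actions N) :
    pulls (idRectify α a) = k ∧ ∃ n ≤ N, (∀ i : Fin N, i.val < n → idRectify α a i = a i) ∧
      min α (1 - α) * (N - n) ≤ |prefixSum (fun i => ((a i : ℕ) : ℝ) - α) n| := by
  classical
  have ha : ∀ i, (a i : ℕ) ≤ 1 := fun i => by omega
  have hdev : ∀ n ≤ N, prefixSum (fun i => ((a i : ℕ) : ℝ) - α) n =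
      (prefixSum (fun i => (a i : ℕ)) n : ℕ) - n * α := fun n hn => by
    have := prefixSum_const (N := N) α hn
    simp only [prefixSum, Finset.sum_sub_distrib, nsmul_eq_mul] at this ⊢
    rw [this]; push_cast; rfl
  by_cases h : α * N ≤ (pulls a : ℝ)
  · have hp : k ≤ ∑ i, (a i : ℕ) := by rw [hk] at h; exact_mod_cast h
    set n := Nat.findGreatest (fun n => (prefixOnes a n : ℝ) ≤ α * N) N with hn
    have hnN : n ≤ N := Nat.findGreatest_le N
    have hsum : prefixSum (fun i => (a i : ℕ)) n = k :=
      prefixSum_findGreatest (fun i => (a i : ℕ)) ha hk hp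
    have hA : idRectify α a = fun i => if i.val < n then a i else 0 := by
      unfold idRectify; rw [if_pos h]
    refine ⟨?_, n, hnN, fun i hi => by rw [hA]; simp [hi], ?_⟩
    · rw [← hsum, hA, pulls, prefixSum, Finset.sum_filter]
      exact Finset.sum_congr rfl fun i _ => by split_ifs <;> simp
    -- The prefix already contains all `α * N` pulls, so its deviation is exactly `α * (N - n)`.
    · rw [hdev n hnN, hsum, ← hk]
      have h1 : (n : ℝ) ≤ N := by exact_mod_cast hnN
      refine le_trans ?_ (le_abs_self _)
      nlinarith [min_le_left α (1 - α)]
  · have hkN : k ≤ N := by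
      have : (k : ℝ) ≤ N := by rw [← hk]; nlinarith [(Nat.cast_nonneg N : (0 : ℝ) ≤ N)]
      exact_mod_cast this
    have hk' : (1 - α) * N = ((N - k : ℕ) : ℝ) := by rw [Nat.cast_sub hkN, ← hk]; ring
    have hcomp : ∀ I : Finset (Fin N), ∑ i ∈ I, (a i : ℕ) + ∑ i ∈ I, (1 - (a i : ℕ)) = I.card := by
      intro I
      rw [← Finset.sum_add_distrib, Finset.card_eq_sum_ones]
      exact Finset.sum_congr rfl fun i _ => by have := ha i; omega
    have hp : N - k ≤ ∑ i, (1 - (a i : ℕ)) := by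
      have h1 : pulls a < k := by rw [hk, not_le] at h; exact_mod_cast h
      have h2 := hcomp Finset.univ
      rw [Finset.card_univ, Fintype.card_fin] at h2
      unfold pulls at h1
      omega
    set n := Nat.findGreatest (fun n => (prefixZeros a n : ℝ) ≤ (1 - α) * N) N with hn
    have hnN : n ≤ N := Nat.findGreatest_le N
    have hsum : prefixSum (fun i => (1 - (a i : ℕ))) n = N - k :=
      prefixSum_findGreatest (fun i => (1 - (a i : ℕ))) (fun i => by omega) hk' hp
    have hA : idRectify α a = fun i => if i.val < n then a i else 1 := by
      unfold idRectify; rw [if_neg h]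
    refine ⟨?_, n, hnN, fun i hi => by rw [hA]; simp [hi], ?_⟩
    · have h1 : pulls (idRectify α a) + prefixSum (fun i => (1 - (a i : ℕ))) n = N := by
        rw [hA, pulls, prefixSum, Finset.sum_filter, ← Finset.sum_add_distrib]
        calc _ = ∑ _i : Fin N, 1 := Finset.sum_congr rfl fun i _ => by
                have := ha i
                by_cases hi : i.val < n
                · simp only [hi, if_true]; omega
                · simp [hi]
          _ = N := by simp
      omega
    · have h2 : prefixSum (fun i => (a i : ℕ)) n + prefixSum (fun i => (1 - (a i : ℕ))) n = n := by
        have h3 := hcomp (Finset.univ.filter fun i : Fin N => i.val < n)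
        have h4 := prefixSum_const (N := N) (1 : ℕ) hnN
        rw [prefixSum, ← Finset.card_eq_sum_ones] at h4
        rw [h4] at h3
        exact h3.trans (by simp)
      have h5 : ((prefixSum (fun i => (a i : ℕ)) n : ℕ) : ℝ) = n - (1 - α) * N := by
        rw [hk', eq_sub_iff_add_eq, ← hsum]
        exact_mod_cast h2
      -- Here the prefix contains all the zeros, and its deviation is `-(1 - α) * (N - n)`.
      rw [hdev n hnN, h5]
      have h1 : (n : ℝ) ≤ N := by exact_mod_cast hnN
      refine le_trans ?_ (neg_le_abs _)
      nlinarith [min_le_right α (1 - α)]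

end Prefix

/-! The Lyapunov function -/

section Lyapunov

variable {N : ℕ} {E : Type*} [NormedAddCommGroup E]

theorem norm_prefixSum_le {f : Fin N → E} {K : ℝ} (hf : ∀ i, ‖f i‖ ≤ K) {m n : ℕ} (hmn : m ≤ n)
    (hn : n ≤ N) : ‖prefixSum f n‖ ≤ ‖prefixSum f m‖ + K * (n - m) := by
  induction n, hmn using Nat.le_induction with
  | base => simp
  | succ n hmn ih =>
    rw [prefixSum_succ f hn]
    have := norm_add_le (prefixSum f n) (f ⟨n, hn⟩)
    have h1 := ih (by omega)
    have h2 := hf ⟨n, hn⟩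
    push_cast
    linarith

open Classical in
/-- The length of the longest prefix all of whose prefixes have a deviation of at most `b` times
the number of the other arms. -/
def focusSize (b : ℝ) (f : Fin N → E) : ℕ :=
  Nat.findGreatest (fun n => ∀ k ≤ n, ‖prefixSum f k‖ ≤ b * (N - n)) N

theorem focusSize_le (b : ℝ) (f : Fin N → E) : focusSize b f ≤ N := Nat.findGreatest_le N

theorem norm_prefixSum_le_of_le_focusSize {b : ℝ} (hb : 0 ≤ b) (f : Fin N → E) {k : ℕ}
    (hk : k ≤ focusSize b f) : ‖prefixSum f k‖ ≤ b * (N - focusSize b f) := by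
  classical
  exact Nat.findGreatest_spec (P := fun n => ∀ k ≤ n, ‖prefixSum f k‖ ≤ b * (N - n))
    (Nat.zero_le N) (fun k hk => by
      rw [Nat.le_zero.1 hk, prefixSum_zero, norm_zero]; simp; positivity) k hk

theorem le_focusSize {b : ℝ} {f : Fin N → E} {n : ℕ} (hn : n ≤ N)
    (h : ∀ k ≤ n, ‖prefixSum f k‖ ≤ b * (N - n)) : n ≤ focusSize b f := by
  classical
  exact Nat.le_findGreatest (P := fun n => ∀ k ≤ n, ‖prefixSum f k‖ ≤ b * (N - n)) hn h

/-- The number of arms outside of the focus set. -/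
def unfocused (b : ℝ) (f : Fin N → E) : ℝ := N - focusSize b f

theorem unfocused_nonneg (b : ℝ) (f : Fin N → E) : 0 ≤ unfocused b f :=
  sub_nonneg.2 (by exact_mod_cast focusSize_le b f)

theorem unfocused_le (b : ℝ) (f : Fin N → E) : unfocused b f ≤ N :=
  sub_le_self _ (Nat.cast_nonneg _)

/-- The focused prefix contributes at most `b` per unfocused arm, and each unfocused arm adds at
most `K` itself. -/
theorem norm_sum_le_unfocused {b K : ℝ} (hb : 0 ≤ b) {f : Fin N → E} (hf : ∀ i, ‖f i‖ ≤ K) :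
    ‖∑ i, f i‖ ≤ (b + K) * unfocused b f := by
  rw [← prefixSum_self]
  have h1 := norm_prefixSum_le hf (focusSize_le b f) le_rfl
  have h2 := norm_prefixSum_le_of_le_focusSize hb f le_rfl
  unfold unfocused
  linarith

/-- If the deviations contract on a prefix that misses few more arms than the focus set, then
the next focus set is larger, up to noise. -/
theorem unfocused_le_of_contraction {b K ρ γ w δ ε : ℝ} (hb : 0 < b) (hK : 0 ≤ K) (hρ : 0 ≤ ρ)
    (hγ0 : 0 ≤ γ) (hγ : (K + b) * γ ≤ (1 - ρ) * b) (hw : 0 ≤ w) (hδ : 0 ≤ δ) (hε : 0 ≤ ε)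
    {f : Fin N → E} (hf : ∀ i, ‖f i‖ ≤ K) {m : ℕ}
    (hc : ∀ k ≤ m, ‖prefixSum f k‖ ≤ ρ * (b * w) + ε) (hm : (N : ℝ) - m ≤ w + δ) :
    unfocused b f ≤ (1 - γ) * w + (ε + K * δ) / b + 1 := by
  have hKγ : 0 ≤ K * γ := mul_nonneg hK hγ0
  have hγρ : γ ≤ 1 - ρ := by
    by_contra! h
    nlinarith
  set q := (ε + K * δ) / b with hq
  have hq0 : 0 ≤ q := by positivity
  have hbq : b * q = ε + K * δ := by rw [hq]; field_simp
  -- `t` is the target number of arms to leave out. A prefix of at most `N - t` arms must deviate by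
  -- at most `b * t`: `hbt` treats those inside the first `m` arms, `hKbt` those reaching beyond.
  set t := (1 - γ) * w + q with ht
  have ht0 : 0 ≤ t := by
    have : 0 ≤ (1 - γ) * w := mul_nonneg (by linarith) hw
    linarith
  have hbt : ρ * (b * w) + ε ≤ b * t := by
    have h1 : b * t = (1 - γ) * (b * w) + (ε + K * δ) := by rw [ht, mul_add, hbq]; ring
    have h2 : ρ * (b * w) ≤ (1 - γ) * (b * w) :=
      mul_le_mul_of_nonneg_right (by linarith) (by positivity)
    have h3 : 0 ≤ K * δ := by positivity
    linarith
  -- Beyond `m` there are at most `w + δ - t` arms to add, at cost `K` each. The hypothesis `hγ`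
  -- says that the slack `(1 - ρ) * b * w` gained by contraction pays for this.
  have hKbt : ρ * (b * w) + ε + K * (w + δ) ≤ (K + b) * t := by
    have h1 : (K + b) * t = (K + b) * w - ((K + b) * γ) * w + K * q + (ε + K * δ) := by
      rw [ht, ← hbq]; ring
    have h2 : ((K + b) * γ) * w ≤ ((1 - ρ) * b) * w := mul_le_mul_of_nonneg_right hγ hw
    have h3 : 0 ≤ K * q := by positivity
    nlinarith
  rcases lt_or_ge (N : ℝ) t with hN | hN
  · linarith [unfocused_le b f]
  -- Rounding down to an integer length is the source of the `+ 1` in the conclusion.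
  set n := ⌊(N : ℝ) - t⌋₊ with hn
  have hn1 : (n : ℝ) ≤ N - t := Nat.floor_le (by linarith)
  have hn2 : (N : ℝ) - t < n + 1 := Nat.lt_floor_add_one _
  have hnN : n ≤ N := by
    have : (n : ℝ) ≤ N := by linarith
    exact_mod_cast this
  have hfoc : n ≤ focusSize b f := by
    refine le_focusSize hnN fun k hk => ?_
    have hkn : (k : ℝ) ≤ n := by exact_mod_cast hk
    have hbn : b * t ≤ b * (N - n) := mul_le_mul_of_nonneg_left (by linarith) hb.le
    rcases le_total k m with hkm | hkm
    · linarith [hc k hkm]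
    · have h1 := norm_prefixSum_le hf hkm (hk.trans hnN)
      have h2 := hc m le_rfl
      have h3 : K * ((k : ℝ) - m) ≤ K * (w + δ - t) := mul_le_mul_of_nonneg_left (by linarith) hK
      nlinarith
  have : (n : ℝ) ≤ focusSize b f := by exact_mod_cast hfoc
  unfold unfocused
  linarith

end Lyapunov

/-! Embeddings of the arm states in a Euclidean space -/

section Embedding

variable {S : Type*} [Fintype S] {E : Type*} [NormedAddCommGroup E] [InnerProductSpace ℝ E]

/-- The conditional mean of the embedded next state, given the state and the action. -/
def nextMean (M : MDP S) (u : S → E) (s : S) (a : Fin 2) : E := ∑ s', M.P s a s' • u s'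

/-- The conditional mean of the embedded next state under the single-armed policy. -/
def idealMean (M : MDP S) (y : S → Fin 2 → ℝ) (u : S → E) (s : S) : E :=
  ∑ a, singleArmProb y s a • nextMean M u s a

/-- An embedding of the states for which the single-armed policy contracts every combination of
states and which controls the deviations of state functions from their means under `μ`. -/
structure IsArmEmbedding (M : MDP S) (y : S → Fin 2 → ℝ) (μ : S → ℝ) (u : S → E) (K ρ : ℝ) :
    Prop where
  norm_le : ∀ s, ‖u s‖ ≤ K
  norm_sub_nextMean_le : ∀ s a s', ‖u s' - nextMean M u s a‖ ≤ K
  norm_nextMean_sub_le : ∀ s a, ‖nextMean M u s a - idealMean M y u s‖ ≤ K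
  contraction : ∀ w : S → ℝ, ‖∑ s, w s • idealMean M y u s‖ ≤ ρ * ‖∑ s, w s • u s‖
  deviation : ∀ (w f : S → ℝ) (C : ℝ), (∀ s, |f s| ≤ C) →
    |∑ s, w s * (f s - ∑ x, μ x * f x)| ≤ C * √(Fintype.card S) * ‖∑ s, w s • u s‖

theorem dotProduct_sub_self_le {p q : S → ℝ} (hp : ∀ s, 0 ≤ p s) (hp1 : ∑ s, p s = 1)
    (hq : ∀ s, 0 ≤ q s) (hq1 : ∑ s, q s = 1) : (p - q) ⬝ᵥ (p - q) ≤ 4 := by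
  have hle : ∀ {p : S → ℝ}, (∀ s, 0 ≤ p s) → ∑ s, p s = 1 → ∀ s, p s ≤ 1 := fun h h1 s =>
    h1 ▸ Finset.single_le_sum (fun i _ => h i) (Finset.mem_univ s)
  calc (p - q) ⬝ᵥ (p - q) ≤ ∑ s, (p s + q s) := by
        refine Finset.sum_le_sum fun s _ => ?_
        have h1 := hle hp hp1 s
        have h2 := hle hq hq1 s
        simp only [Pi.sub_apply]
        nlinarith [hp s, hq s, mul_nonneg (hp s) (hq s)]
    _ ≤ 4 := by rw [Finset.sum_add_distrib, hp1, hq1]; norm_num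

/-- The three norm bounds all compare images of two probability vectors, whose squared distance is
at most `4`; this gives `2 * √l`. Contraction and deviation are properties of the centered vector `w
- (∑ s, w s) • μ`, on which `Q` and `Q - Ξ` agree. -/
theorem IsWeightMatrix.exists_isArmEmbedding [DecidableEq S] [Nonempty S] {M : MDP S} {α : ℝ}
    {y : S → Fin 2 → ℝ} (hy : IsLPFeasible M α y) {W : Matrix S S ℝ} {l : ℝ}
    (hW : IsWeightMatrix (singleArmMatrix M y) (fun s => ∑ a, y s a) W)
    (hl : IsMaxEigenvalue W l) :
    1 ≤ l ∧ ∃ u : S → EuclideanSpace ℝ S,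
      IsArmEmbedding M y (fun s => ∑ a, y s a) u (2 * √l) (1 - 1 / (2 * l)) := by
  obtain ⟨hl1, L, hL⟩ := hW.exists_linearMap hl
  refine ⟨hl1, ?_⟩
  have hl0 : 0 < l := by linarith
  have hμ := hy.isStationary
  have hQ := hy.isStochastic
  set Q := singleArmMatrix M y with hQdef
  set μ : S → ℝ := fun s => ∑ a, y s a with hμdef
  let u : S → EuclideanSpace ℝ S := fun s => L (Pi.single s 1 - μ)
  have hu : ∀ w : S → ℝ, ∑ s, w s • u s = L (w - (∑ s, w s) • μ) := by
    intro w
    simp only [u, ← map_smul, ← map_sum]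
    congr 1
    simp only [smul_sub, Finset.sum_sub_distrib, ← Finset.sum_smul]
    congr 1
    ext x
    simp [Finset.sum_apply, Pi.single_apply]
  have hprob : ∀ p q : S → ℝ, (∀ s, 0 ≤ p s) → ∑ s, p s = 1 → (∀ s, 0 ≤ q s) → ∑ s, q s = 1 →
      ‖L (p - μ) - L (q - μ)‖ ≤ 2 * √l := by
    intro p q hp hp1 hq hq1
    rw [← map_sub, sub_sub_sub_cancel_right]
    refine abs_le_of_sq_le_sq' ?_ (by positivity) |>.2
    rw [mul_pow, Real.sq_sqrt hl0.le]
    have := mul_le_mul_of_nonneg_left (dotProduct_sub_self_le hp hp1 hq hq1) hl0.le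
    linarith [(hL (p - q)).2.1]
  have hnext : ∀ s a, nextMean M u s a = L (M.P s a - μ) := by
    intro s a
    rw [nextMean, hu, M.sum_P, one_smul]
  have hideal : ∀ s, idealMean M y u s = ∑ s', Q s s' • u s' := by
    intro s
    simp only [idealMean, nextMean, hQdef, singleArmMatrix, Matrix.of_apply, Finset.smul_sum,
      Finset.sum_smul, smul_smul]
    exact Finset.sum_comm
  have hideal' : ∀ s, idealMean M y u s = L (Q s - μ) := by
    intro s
    rw [hideal, hu, hQ.row_sum, one_smul]
  have hsingle : ∀ s, (∀ x, 0 ≤ (Pi.single s 1 : S → ℝ) x) ∧ ∑ x, (Pi.single s 1 : S → ℝ) x = 1 :=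
    fun s => ⟨fun x => by rw [Pi.single_apply]; split_ifs <;> norm_num, by simp⟩
  refine ⟨u, fun s => ?_, fun s a s' => ?_, fun s a => ?_, fun w => ?_, fun w f C hf => ?_⟩
  · have := hprob _ μ (hsingle s).1 (hsingle s).2 hμ.1 hμ.2.1
    simpa [u] using this
  · rw [hnext]
    exact hprob _ _ (hsingle s').1 (hsingle s').2 (M.P_nonneg s a) (M.sum_P s a)
  · rw [hnext, hideal']
    exact hprob _ _ (M.P_nonneg s a) (M.sum_P s a) (hQ.nonneg s) (hQ.row_sum s)
  · set v := w - (∑ s, w s) • μ with hv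
    have hv0 : ∑ s, v s = 0 := by
      simp [hv, Finset.sum_sub_distrib, ← Finset.mul_sum, hμ.2.1]
    have h1 : ∑ s, w s • idealMean M y u s = L (Matrix.vecMul v (Q - constRows μ)) := by
      have h2 : ∑ s, w s • idealMean M y u s = ∑ s', Matrix.vecMul w Q s' • u s' := by
        simp only [hideal, Matrix.vecMul, dotProduct, Finset.smul_sum, Finset.sum_smul, smul_smul]
        exact Finset.sum_comm
      have h3 : ∑ s', Matrix.vecMul w Q s' = ∑ s, w s := by
        simp only [Matrix.vecMul, dotProduct]
        rw [Finset.sum_comm]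
        simp [← Finset.mul_sum, hQ.row_sum]
      rw [h2, hu, h3, vecMul_sub_constRows_of_sum_eq_zero hv0, hv, Matrix.sub_vecMul,
        Matrix.smul_vecMul, hμ.2.2]
    rw [h1, hu]
    have hρ : 0 ≤ 1 - 1 / (2 * l) := by
      rw [sub_nonneg, div_le_one (by positivity)]; linarith
    refine abs_le_of_sq_le_sq' ?_ (by positivity) |>.2
    refine (hL v).2.2.trans ?_
    rw [mul_pow]
    refine mul_le_mul_of_nonneg_right ?_ (sq_nonneg _)
    -- The squared norm contracts by `1 - 1 / l`; completing the square gives a rational factor for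
    -- the norm.
    have : (1 - 1 / (2 * l)) ^ 2 = 1 - 1 / l + (1 / (2 * l)) ^ 2 := by field_simp; ring
    rw [this]
    linarith [sq_nonneg (1 / (2 * l))]
  · rw [hu]
    set v := w - (∑ s, w s) • μ with hv
    -- Centering `f` against `μ` is the same as centering the weights; Cauchy–Schwarz then yields
    -- the factor `√(Fintype.card S)`.
    have h1 : ∑ s, w s * (f s - ∑ x, μ x * f x) = ∑ s, v s * f s := by
      simp only [hv, Pi.sub_apply, Pi.smul_apply, smul_eq_mul, sub_mul, mul_sub,
        Finset.sum_sub_distrib, ← Finset.sum_mul, mul_assoc, ← Finset.mul_sum]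
    have hC : 0 ≤ C := (abs_nonneg _).trans (hf (Classical.arbitrary S))
    have h2 : ∑ s, |v s| ≤ √(Fintype.card S) * ‖L v‖ := by
      refine abs_le_of_sq_le_sq' ?_ (by positivity) |>.2
      rw [mul_pow, Real.sq_sqrt (Nat.cast_nonneg _)]
      refine (sq_sum_le_card_mul_sum_sq (s := Finset.univ) (f := fun s => |v s|)).trans ?_
      rw [Finset.card_univ]
      refine mul_le_mul_of_nonneg_left ?_ (Nat.cast_nonneg _)
      refine le_trans (le_of_eq ?_) (hL v).1
      exact Finset.sum_congr rfl fun s _ => by rw [sq_abs, sq]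
    rw [h1]
    calc |∑ s, v s * f s| ≤ ∑ s, |v s| * C := by
          refine (Finset.abs_sum_le_sum_abs _ _).trans (Finset.sum_le_sum fun s _ => ?_)
          rw [abs_mul]
          exact mul_le_mul_of_nonneg_left (hf s) (abs_nonneg _)
      _ = C * ∑ s, |v s| := by rw [← Finset.sum_mul, mul_comm]
      _ ≤ C * (√(Fintype.card S) * ‖L v‖) := mul_le_mul_of_nonneg_left h2 hC
      _ = _ := by ring

end Embedding

/-! Drift and reward gap of the ID policy -/

section Drift

variable {S : Type*} [Fintype S] {E : Type*} [NormedAddCommGroup E] [InnerProductSpace ℝ E]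
  {M : MDP S} {α : ℝ} {y : S → Fin 2 → ℝ} {u : S → E} {K ρ : ℝ} {N : ℕ}

/-- The maximal deviation of the prefix sums of the ideal actions from their means. -/
def actionNoise (y : S → Fin 2 → ℝ) (s : Fin N → S) (a : Actions N) : ℝ :=
  maxPartial N (fun i => ((a i : ℕ) : ℝ) - singleArmProb y (s i) 1) 0 0

/-- The maximal deviation of the prefix sums of the embedded mean transitions under the ideal
actions from their means. -/
def driftNoise (M : MDP S) (y : S → Fin 2 → ℝ) (u : S → E) (s : Fin N → S) (a : Actions N) : ℝ :=
  maxPartial N (fun i => nextMean M u (s i) (a i) - idealMean M y u (s i)) 0 0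

/-- The maximal deviation of the prefix sums of the embedded next states from their means. -/
def transitionNoise (M : MDP S) (u : S → E) (s : Fin N → S) (a : Actions N) (s' : Fin N → S) : ℝ :=
  maxPartial N (fun i => u (s' i) - nextMean M u (s i) (a i)) 0 0

omit [InnerProductSpace ℝ E] in
theorem norm_prefixSum_le_maxPartial (f : Fin N → E) (k : ℕ) :
    ‖prefixSum f k‖ ≤ maxPartial N f 0 0 := by
  simpa [prefixSum] using norm_prefix_le_maxPartial N f 0 0 (by simp) k

theorem expect_actionNoise_le (hN : 0 < N) (hy : IsLPFeasible M α y) (s : Fin N → S) :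
    expect (indepPMF fun i => idealAction hy (s i)) (actionNoise y s) ≤ 2 * √N := by
  have h := expect_maxPartial_le N hN (fun i => idealAction hy (s i))
    (fun i a => ((a : ℕ) : ℝ) - singleArmProb y (s i) 1) 1 (fun i => ?_) one_pos fun i a => ?_
  · rw [mul_one] at h; exact h
  · have := sum_singleArmProb y (s i)
    rw [Fin.sum_univ_two] at this
    simp only [hy.idealAction_toReal, Fin.sum_univ_two, smul_eq_mul]
    simp
    linear_combination (-singleArmProb y (s i) 1) * this
  · have h1 := sum_singleArmProb y (s i)
    have h2 := hy.singleArmProb_nonneg (s i) 0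
    have h3 := hy.singleArmProb_nonneg (s i) 1
    rw [Fin.sum_univ_two] at h1
    rw [Real.norm_eq_abs, abs_le]
    fin_cases a <;> constructor <;> simp <;> linarith

variable {μ : S → ℝ}

theorem IsArmEmbedding.expect_driftNoise_le (hu : IsArmEmbedding M y μ u K ρ) (hK : 0 < K)
    (hN : 0 < N) (hy : IsLPFeasible M α y) (s : Fin N → S) :
    expect (indepPMF fun i => idealAction hy (s i)) (driftNoise M y u s) ≤ 2 * K * √N := by
  refine expect_maxPartial_le N hN (fun i => idealAction hy (s i))
    (fun i a => nextMean M u (s i) a - idealMean M y u (s i)) K (fun i => ?_) hK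
    fun i a => hu.norm_nextMean_sub_le _ _
  simp only [hy.idealAction_toReal, smul_sub, Finset.sum_sub_distrib, ← Finset.sum_smul,
    sum_singleArmProb, one_smul]
  exact sub_self _

theorem IsArmEmbedding.expect_transitionNoise_le (hu : IsArmEmbedding M y μ u K ρ) (hK : 0 < K)
    (hN : 0 < N) (s : Fin N → S) (a : Actions N) :
    expect (nextStates M s a) (transitionNoise M u s a) ≤ 2 * K * √N := by
  refine expect_maxPartial_le N hN (fun i => M.trans (s i) (a i))
    (fun i s' => u s' - nextMean M u (s i) (a i)) K (fun i => ?_) hK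
    fun i s' => hu.norm_sub_nextMean_le _ _ _
  simp only [smul_sub, Finset.sum_sub_distrib, ← Finset.sum_smul, sum_toReal, one_smul]
  exact sub_self _

theorem IsLPFeasible.sum_mul_singleArmProb_one (hy : IsLPFeasible M α y) :
    ∑ x, (∑ a, y x a) * singleArmProb y x 1 = α := by
  simp only [hy.sum_mul_singleArmProb]
  exact hy.budget

/-- The prefix on which the ideal actions are followed misses few more arms than the focus set. -/
theorem IsArmEmbedding.exists_followed_prefix [Nonempty S] (hy : IsLPFeasible M α y)
    (hu : IsArmEmbedding M y (fun s => ∑ a, y s a) u K ρ)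
    (hα0 : 0 < α) (hα1 : α < 1) {k : ℕ} (hk : α * N = k) (s : Fin N → S) (a : Actions N) :
    ∃ n ≤ N, (∀ i : Fin N, i.val < n → idRectify α a i = a i) ∧
      (N : ℝ) - n ≤ unfocused (2 * min α (1 - α) / √(Fintype.card S)) (fun i => u (s i)) +
        actionNoise y s a / min α (1 - α) := by
  obtain ⟨-, n, hnN, hfol, hdev⟩ := idRectify_spec hα0 hα1 hk a
  refine ⟨n, hnN, hfol, ?_⟩
  set β := min α (1 - α) with hβ
  have hβ0 : 0 < β := lt_min hα0 (by linarith)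
  have hσ : 0 < √(Fintype.card S : ℝ) := Real.sqrt_pos.2 (by exact_mod_cast Fintype.card_pos)
  set b := 2 * β / √(Fintype.card S) with hb
  have hb0 : 0 ≤ b := by positivity
  set f : Fin N → E := fun i => u (s i) with hf
  have hnoise : 0 ≤ actionNoise y s a := le_maxPartial _ _ _ _
  have hnoise' : 0 ≤ actionNoise y s a / β := by positivity
  rcases le_total n (focusSize b f) with hn | hn
  · have h1 := norm_prefixSum_le_of_le_focusSize hb0 f hn
    have h2 : |prefixSum (fun i => singleArmProb y (s i) 1 - α) n| ≤
        1 / 2 * √(Fintype.card S) * ‖prefixSum f n‖ := by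
      -- Shifting the pull probability by `1 / 2` halves its sup norm, so `b = 2 * β /
      -- √(Fintype.card S)` turns the focus bound into exactly `β` per unfocused arm.
      have h3 := hu.deviation (stateCount s n) (fun x => singleArmProb y x 1 - 1 / 2) (1 / 2)
        fun x => by
          have h4 := sum_singleArmProb y x
          rw [Fin.sum_univ_two] at h4
          rw [abs_le]
          constructor <;> linarith [hy.singleArmProb_nonneg x 0, hy.singleArmProb_nonneg x 1]
      have h5 : ∑ x, (∑ a, y x a) * (singleArmProb y x 1 - 1 / 2) = α - 1 / 2 := by
        simp only [mul_sub, Finset.sum_sub_distrib, ← Finset.sum_mul, hy.total,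
          hy.sum_mul_singleArmProb_one]
        ring
      rw [h5] at h3
      rw [hf, prefixSum_comp s u, prefixSum_comp s fun x => singleArmProb y x 1 - α]
      simpa using h3
    have h6 : ‖prefixSum (fun i => ((a i : ℕ) : ℝ) - singleArmProb y (s i) 1) n‖ ≤
        actionNoise y s a := norm_prefixSum_le_maxPartial _ n
    have h7 : prefixSum (fun i => ((a i : ℕ) : ℝ) - α) n =
        prefixSum (fun i => ((a i : ℕ) : ℝ) - singleArmProb y (s i) 1) n +
          prefixSum (fun i => singleArmProb y (s i) 1 - α) n := by
      rw [← prefixSum_add]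
      exact prefixSum_congr fun i _ => by ring
    have h8 : 1 / 2 * √(Fintype.card S) * ‖prefixSum f n‖ ≤ β * unfocused b f := by
      calc 1 / 2 * √(Fintype.card S) * ‖prefixSum f n‖
          ≤ 1 / 2 * √(Fintype.card S) * (b * unfocused b f) :=
            mul_le_mul_of_nonneg_left h1 (by positivity)
        _ = β * unfocused b f := by rw [hb]; field_simp
    rw [h7] at hdev
    have h9 : β * ((N : ℝ) - n) ≤ β * (unfocused b f + actionNoise y s a / β) := by
      rw [mul_add, mul_div_cancel₀ _ hβ0.ne']
      have := abs_add_le (prefixSum (fun i => ((a i : ℕ) : ℝ) - singleArmProb y (s i) 1) n)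
        (prefixSum (fun i => singleArmProb y (s i) 1 - α) n)
      rw [Real.norm_eq_abs] at h6
      linarith
    exact le_of_mul_le_mul_left h9 hβ0
  · have : (focusSize b f : ℝ) ≤ n := by exact_mod_cast hn
    unfold unfocused
    linarith

/-- The pathwise drift of the number of unfocused arms under the ID policy. -/
theorem IsArmEmbedding.unfocused_next_le [Nonempty S] (hy : IsLPFeasible M α y)
    (hu : IsArmEmbedding M y (fun s => ∑ a, y s a) u K ρ) (hK : 0 ≤ K) (hρ : 0 ≤ ρ)
    (hα0 : 0 < α) (hα1 : α < 1) {k : ℕ} (hk : α * N = k) {b γ : ℝ}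
    (hb : b = 2 * min α (1 - α) / √(Fintype.card S)) (hγ0 : 0 ≤ γ)
    (hγ : (K + b) * γ ≤ (1 - ρ) * b) (s s' : Fin N → S) (a : Actions N) :
    unfocused b (fun i => u (s' i)) ≤ (1 - γ) * unfocused b (fun i => u (s i)) +
      (driftNoise M y u s a + transitionNoise M u s (idRectify α a) s' +
        K * (actionNoise y s a / min α (1 - α))) / b + 1 := by
  obtain ⟨n, hnN, hfol, hn⟩ := hu.exists_followed_prefix hy hα0 hα1 hk s a
  rw [← hb] at hn
  have hβ0 : 0 < min α (1 - α) := lt_min hα0 (by linarith)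
  have hσ : 0 < √(Fintype.card S : ℝ) := Real.sqrt_pos.2 (by exact_mod_cast Fintype.card_pos)
  have hb0 : 0 < b := by rw [hb]; positivity
  have hn1 : 0 ≤ driftNoise M y u s a := le_maxPartial _ _ _ _
  have hn2 : 0 ≤ transitionNoise M u s (idRectify α a) s' := le_maxPartial _ _ _ _
  have hn3 : 0 ≤ actionNoise y s a := le_maxPartial _ _ _ _
  set f : Fin N → E := fun i => u (s i) with hf
  -- Up to this `m` the ideal actions are executed and the current deviation is controlled.
  refine unfocused_le_of_contraction (m := min n (focusSize b f)) hb0 hK hρ hγ0 hγ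
    (unfocused_nonneg b f) (by positivity) (by positivity) (fun i => hu.norm_le _)
    (fun j hj => ?_) ?_
  -- Transition noise is centered given the executed actions and drift noise given the states. On
  -- the followed prefix the two kinds of action agree, so the terms telescope.
  · have h1 : prefixSum (fun i => u (s' i)) j =
        prefixSum (fun i => u (s' i) - nextMean M u (s i) (idRectify α a i)) j +
        prefixSum (fun i => nextMean M u (s i) (a i) - idealMean M y u (s i)) j +
        prefixSum (fun i => idealMean M y u (s i)) j := by
      rw [← prefixSum_add, ← prefixSum_add]
      refine prefixSum_congr fun i hi => ?_
      rw [hfol i (hi.trans_le (hj.trans (min_le_left _ _)))]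
      abel
    have h2 : ‖prefixSum (fun i => idealMean M y u (s i)) j‖ ≤ ρ * ‖prefixSum f j‖ := by
      rw [hf, prefixSum_comp s (idealMean M y u), prefixSum_comp s u]
      exact hu.contraction _
    have h3 := norm_prefixSum_le_of_le_focusSize hb0.le f (hj.trans (min_le_right _ _))
    have h4 := mul_le_mul_of_nonneg_left h3 hρ
    have h5 : ‖prefixSum (fun i => u (s' i) - nextMean M u (s i) (idRectify α a i)) j‖ ≤
        transitionNoise M u s (idRectify α a) s' := norm_prefixSum_le_maxPartial _ j
    have h6 : ‖prefixSum (fun i => nextMean M u (s i) (a i) - idealMean M y u (s i)) j‖ ≤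
        driftNoise M y u s a := norm_prefixSum_le_maxPartial _ j
    rw [h1]
    refine norm_add₃_le.trans ?_
    unfold unfocused
    linarith
  · have h0 : 0 ≤ actionNoise y s a / min α (1 - α) := by positivity
    rcases le_total n (focusSize b f) with h | h
    · rwa [min_eq_left h]
    · rw [min_eq_right h]
      unfold unfocused
      linarith

/-- The transition kernel of the state vector under the ID policy. -/
def idKernel (N : ℕ) (hy : IsLPFeasible M α y) (s : Fin N → S) : PMF (Fin N → S) :=
  (indepPMF fun i => idealAction hy (s i)).bind fun a => nextStates M s (idRectify α a)

/-- The drift of the number of unfocused arms under the ID policy. -/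
theorem IsArmEmbedding.expect_idKernel_unfocused_le [Nonempty S] (hN : 0 < N)
    (hy : IsLPFeasible M α y)
    (hu : IsArmEmbedding M y (fun s => ∑ a, y s a) u K ρ) (hK : 0 < K) (hρ : 0 ≤ ρ)
    (hα0 : 0 < α) (hα1 : α < 1) {k : ℕ} (hk : α * N = k) {b γ : ℝ}
    (hb : b = 2 * min α (1 - α) / √(Fintype.card S)) (hγ0 : 0 ≤ γ)
    (hγ : (K + b) * γ ≤ (1 - ρ) * b) (s : Fin N → S) :
    expect (idKernel N hy s) (fun s' => unfocused b fun i => u (s' i)) ≤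
      (1 - γ) * unfocused b (fun i => u (s i)) +
        ((4 * K + 2 * K / min α (1 - α)) * √N / b + 1) := by
  have hβ0 : 0 < min α (1 - α) := lt_min hα0 (by linarith)
  set β := min α (1 - α) with hβ
  have hσ : 0 < √(Fintype.card S : ℝ) := Real.sqrt_pos.2 (by exact_mod_cast Fintype.card_pos)
  have hb0 : 0 < b := by rw [hb]; positivity
  set w := unfocused b fun i => u (s i) with hw
  rw [idKernel, expect_bind]
  have hinner : ∀ a, expect (nextStates M s (idRectify α a))
      (fun s' => unfocused b fun i => u (s' i)) ≤
      ((1 - γ) * w + 1 + 2 * K * √N / b) + (1 / b) * driftNoise M y u s a +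
        (K / (β * b)) * actionNoise y s a := by
    intro a
    have h1 : ∀ s', unfocused b (fun i => u (s' i)) ≤
        ((1 - γ) * w + 1 + (1 / b) * driftNoise M y u s a + (K / (β * b)) * actionNoise y s a) +
          (1 / b) * transitionNoise M u s (idRectify α a) s' := by
      intro s'
      refine (hu.unfocused_next_le hy hK.le hρ hα0 hα1 hk hb hγ0 hγ s s' a).trans (le_of_eq ?_)
      rw [← hβ, ← hw]
      field_simp
      ring
    refine (expect_mono _ h1).trans ?_
    rw [expect_add, expect_const, expect_const_mul]
    have h2 := mul_le_mul_of_nonneg_left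
      (hu.expect_transitionNoise_le hK hN s (idRectify α a)) (by positivity : 0 ≤ 1 / b)
    have h3 : (1 / b) * (2 * K * √N) = 2 * K * √N / b := by ring
    linarith
  refine (expect_mono _ hinner).trans ?_
  rw [expect_add, expect_add, expect_const, expect_const_mul, expect_const_mul]
  have h1 := mul_le_mul_of_nonneg_left (hu.expect_driftNoise_le hK hN hy s)
    (by positivity : 0 ≤ 1 / b)
  have h2 := mul_le_mul_of_nonneg_left (expect_actionNoise_le hN hy s)
    (by positivity : 0 ≤ K / (β * b))
  have h3 : (1 / b) * (2 * K * √N) + K / (β * b) * (2 * √N) + 2 * K * √N / b =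
      (4 * K + 2 * K / β) * √N / b := by field_simp; ring
  linarith

/-- The expected one-step reward per arm of the ID policy. -/
def idReward (N : ℕ) (hy : IsLPFeasible M α y) (s : Fin N → S) : ℝ :=
  expect (indepPMF fun i => idealAction hy (s i)) fun a =>
    (1 / (N : ℝ)) * ∑ i, M.reward (s i) (idRectify α a i)

theorem MDP.rmax_nonneg [Nonempty S] (M : MDP S) : 0 ≤ M.rmax :=
  (abs_nonneg _).trans (M.abs_reward_le (Classical.arbitrary S) 0)

/-- The gap between the value of the linear program and the one-step reward of the ID policy. -/
theorem IsArmEmbedding.lpValue_sub_idReward_le [Nonempty S] (hN : 0 < N)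
    (hy : IsLPFeasible M α y)
    (hu : IsArmEmbedding M y (fun s => ∑ a, y s a) u K ρ)
    (hα0 : 0 < α) (hα1 : α < 1) {k : ℕ} (hk : α * N = k) {b : ℝ}
    (hb : b = 2 * min α (1 - α) / √(Fintype.card S)) (s : Fin N → S) :
    lpValue M y - idReward N hy s ≤
      M.rmax * (√(Fintype.card S) * (b + K) + 2) / N * unfocused b (fun i => u (s i)) +
        4 * M.rmax * √N / (min α (1 - α) * N) := by
  have hβ0 : 0 < min α (1 - α) := lt_min hα0 (by linarith)
  set β := min α (1 - α) with hβ
  have hσ : 0 < √(Fintype.card S : ℝ) := Real.sqrt_pos.2 (by exact_mod_cast Fintype.card_pos)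
  have hb0 : 0 < b := by rw [hb]; positivity
  have hN0 : (0 : ℝ) < N := by exact_mod_cast hN
  have hr := M.rmax_nonneg
  set w := unfocused b fun i => u (s i) with hw
  let rbar : S → ℝ := fun x => ∑ a, singleArmProb y x a * M.reward x a
  have hideal : expect (indepPMF fun i => idealAction hy (s i))
      (fun a => ∑ i, M.reward (s i) (a i)) = ∑ i, rbar (s i) := by
    rw [expect_sum]
    refine Finset.sum_congr rfl fun i _ => ?_
    rw [expect_indepPMF_apply (fun i => idealAction hy (s i)) i (M.reward (s i))]
    simp only [expect, hy.idealAction_toReal, rbar]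
  have hlp : ∑ x, (∑ a, y x a) * rbar x = lpValue M y := by
    simp only [rbar, lpValue, Finset.mul_sum]
    refine Finset.sum_congr rfl fun x _ => Finset.sum_congr rfl fun a _ => ?_
    rw [← mul_assoc, hy.sum_mul_singleArmProb, mul_comm]
  have hrbar : ∀ x, |rbar x| ≤ M.rmax := by
    intro x
    calc |rbar x| ≤ ∑ a, singleArmProb y x a * M.rmax := by
          refine (Finset.abs_sum_le_sum_abs _ _).trans (Finset.sum_le_sum fun a _ => ?_)
          rw [abs_mul, abs_of_nonneg (hy.singleArmProb_nonneg x a)]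
          exact mul_le_mul_of_nonneg_left (M.abs_reward_le x a) (hy.singleArmProb_nonneg x a)
      _ = M.rmax := by rw [← Finset.sum_mul, sum_singleArmProb, one_mul]
  have hdev : N * lpValue M y - ∑ i, rbar (s i) ≤
      M.rmax * √(Fintype.card S) * ((b + K) * w) := by
    have h1 := hu.deviation (stateCount s N) rbar M.rmax hrbar
    have h2 := prefixSum_comp s (fun x => rbar x - lpValue M y) N
    rw [prefixSum_self, Finset.sum_sub_distrib] at h2
    rw [hlp, ← prefixSum_comp s u, prefixSum_self] at h1
    simp only [smul_eq_mul] at h2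
    rw [← h2] at h1
    have h3 := norm_sum_le_unfocused (N := N) hb0.le (f := fun i => u (s i)) fun i => hu.norm_le _
    have h4 := mul_le_mul_of_nonneg_left h3 (by positivity : 0 ≤ M.rmax * √(Fintype.card S : ℝ))
    have h5 := (abs_le.1 h1).1
    simp only [Finset.sum_const, Finset.card_univ, Fintype.card_fin, nsmul_eq_mul] at h5
    linarith
  -- Each arm outside the followed prefix costs at most `2 * M.rmax`.
  have hrect : ∀ a : Actions N, ∑ i, M.reward (s i) (a i) -
      2 * M.rmax * (w + actionNoise y s a / β) ≤ ∑ i, M.reward (s i) (idRectify α a i) := by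
    intro a
    obtain ⟨n, hnN, hfol, hn⟩ := hu.exists_followed_prefix hy hα0 hα1 hk s a
    rw [← hb, ← hβ, ← hw] at hn
    have h1 : ∑ i, (M.reward (s i) (a i) - M.reward (s i) (idRectify α a i)) ≤
        ∑ i : Fin N, (2 * M.rmax - if i.val < n then 2 * M.rmax else 0) := by
      refine Finset.sum_le_sum fun i _ => ?_
      split_ifs with hi
      · rw [hfol i hi]; simp
      · have h2 := abs_le.1 (M.abs_reward_le (s i) (a i))
        have h3 := abs_le.1 (M.abs_reward_le (s i) (idRectify α a i))
        linarith [h2.2, h3.1]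
    rw [Finset.sum_sub_distrib, Finset.sum_sub_distrib, ← Finset.sum_filter] at h1
    have h4 := prefixSum_const (N := N) (2 * M.rmax) hnN
    rw [prefixSum] at h4
    rw [h4] at h1
    simp only [Finset.sum_const, Finset.card_univ, Fintype.card_fin, nsmul_eq_mul] at h1
    have h5 := mul_le_mul_of_nonneg_left hn (by positivity : 0 ≤ 2 * M.rmax)
    linarith
  have hexp : ∑ i, rbar (s i) - 2 * M.rmax * w - 2 * M.rmax / β * (2 * √N) ≤
      N * idReward N hy s := by
    rw [idReward, expect_const_mul, ← mul_assoc (N : ℝ), mul_one_div_cancel hN0.ne', one_mul]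
    refine le_trans ?_ (expect_mono _ hrect)
    have h1 : ∀ a : Actions N, ∑ i, M.reward (s i) (a i) -
        2 * M.rmax * (w + actionNoise y s a / β) = (∑ i, M.reward (s i) (a i) - 2 * M.rmax * w) -
        2 * M.rmax / β * actionNoise y s a := fun a => by ring
    simp only [h1]
    rw [expect_sub, expect_sub, expect_const, expect_const_mul, hideal]
    have h2 := mul_le_mul_of_nonneg_left (expect_actionNoise_le hN hy s)
      (by positivity : 0 ≤ 2 * M.rmax / β)
    linarith
  have hfin : N * (lpValue M y - idReward N hy s) ≤
      M.rmax * (√(Fintype.card S) * (b + K) + 2) * w + 4 * M.rmax * √N / β := by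
    have : 2 * M.rmax / β * (2 * √N) = 4 * M.rmax * √N / β := by ring
    linarith
  rw [← le_div_iff₀' hN0] at hfin
  refine hfin.trans (le_of_eq ?_)
  field_simp

end Drift

/-! Long-run average of the ID policy -/

section LongRun

/-- Foster–Lyapunov bound for a long-run average. -/
theorem sub_le_of_drift {X : Type*} [Fintype X] {κ : X → PMF X} {F g : X → ℝ} {x₀ : X}
    {γ C v c₁ c₂ R : ℝ} (hγ : 0 < γ) (hF : ∀ x, 0 ≤ F x) (hc₁ : 0 ≤ c₁)
    (hdrift : ∀ x, expect (κ x) F ≤ (1 - γ) * F x + C) (hg : ∀ x, v - g x ≤ c₁ * F x + c₂)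
    (hR : Tendsto (fun T : ℕ => (1 / (T : ℝ)) * ∑ t ∈ Finset.range T, (stepOp κ ^ t) g x₀)
      atTop (𝓝 R)) : v - R ≤ c₁ * (C / γ) + c₂ := by
  set a : ℕ → ℝ := fun t => (stepOp κ ^ t) F x₀ with ha
  have ha0 : ∀ t, 0 ≤ a t := fun t => by
    have := stepOp_pow_mono κ t hF x₀
    rwa [stepOp_pow_const] at this
  have hadd : ∀ (t : ℕ) (p q : ℝ) (f : X → ℝ), (stepOp κ ^ t) (fun x => p * f x + q) x₀ =
      p * (stepOp κ ^ t) f x₀ + q := by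
    intro t p q f
    have : (fun x => p * f x + q) = p • f + fun _ => q := rfl
    rw [this, map_add, map_smul, stepOp_pow_const]
    rfl
  have hrec : ∀ t, a (t + 1) ≤ (1 - γ) * a t + C := fun t => by
    have := stepOp_pow_mono κ t hdrift x₀
    rw [hadd] at this
    simp only [ha, pow_succ, Module.End.mul_apply]
    exact this
  have hgap : ∀ t, v - (stepOp κ ^ t) g x₀ ≤ c₁ * a t + c₂ := fun t => by
    have := stepOp_pow_mono κ t hg x₀
    rw [hadd] at this
    have h1 := hadd t (-1) v g
    simp only [neg_one_mul, neg_add_eq_sub] at h1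
    rwa [h1] at this
  -- Summing the drift inequality over time; the initial value disappears after division by `T`.
  have hsum : ∀ T : ℕ, γ * ∑ t ∈ Finset.range T, a t ≤ a 0 - a T + T * C := by
    intro T
    induction T with
    | zero => simp
    | succ T ih =>
      rw [Finset.sum_range_succ]
      push_cast
      linarith [hrec T]
  have hbound : ∀ T : ℕ, 0 < T →
      v - (1 / (T : ℝ)) * ∑ t ∈ Finset.range T, (stepOp κ ^ t) g x₀ ≤
        (1 / (T : ℝ)) * (c₁ * (a 0 / γ)) + (c₁ * (C / γ) + c₂) := by
    intro T hT
    have hT0 : (0 : ℝ) < T := by exact_mod_cast hT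
    have h1 := Finset.sum_le_sum fun t (_ : t ∈ Finset.range T) => hgap t
    simp only [Finset.sum_sub_distrib, Finset.sum_add_distrib, ← Finset.mul_sum, Finset.sum_const,
      Finset.card_range, nsmul_eq_mul] at h1
    have h2 : ∑ t ∈ Finset.range T, a t ≤ (a 0 + T * C) / γ := by
      rw [le_div_iff₀' hγ]
      linarith [hsum T, ha0 T]
    have h3 := mul_le_mul_of_nonneg_left h2 hc₁
    have h4 : T * (v - (1 / (T : ℝ)) * ∑ t ∈ Finset.range T, (stepOp κ ^ t) g x₀) ≤
        T * ((1 / (T : ℝ)) * (c₁ * (a 0 / γ)) + (c₁ * (C / γ) + c₂)) := by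
      have e1 : T * (v - (1 / (T : ℝ)) * ∑ t ∈ Finset.range T, (stepOp κ ^ t) g x₀) =
          T * v - ∑ t ∈ Finset.range T, (stepOp κ ^ t) g x₀ := by field_simp
      have e2 : T * ((1 / (T : ℝ)) * (c₁ * (a 0 / γ)) + (c₁ * (C / γ) + c₂)) =
          c₁ * ((a 0 + T * C) / γ) + T * c₂ := by field_simp; ring
      rw [e1, e2]
      linarith
    exact le_of_mul_le_mul_left h4 hT0
  have hlim : Tendsto (fun T : ℕ => (1 / (T : ℝ)) * (c₁ * (a 0 / γ)) + (c₁ * (C / γ) + c₂)) atTop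
      (𝓝 (c₁ * (C / γ) + c₂)) := by
    simpa using (tendsto_one_div_atTop_nhds_zero_nat.mul_const (c₁ * (a 0 / γ))).add_const
      (c₁ * (C / γ) + c₂)
  refine le_of_tendsto_of_tendsto (tendsto_const_nhds.sub hR) hlim ?_
  filter_upwards [eventually_gt_atTop 0] with T hT using hbound T hT

variable {S : Type*} [Fintype S] {M : MDP S} {α : ℝ} {y : S → Fin 2 → ℝ} {N : ℕ}

/-- The ID policy looks only at the current states, so under it the state vector is a Markov chain.
-/
theorem expect_historyLaw_idPolicy (hy : IsLPFeasible M α y) (s₀ : Fin N → S) (t : ℕ)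
    (g : (Fin N → S) → ℝ) :
    expect (historyLaw M (idPolicy N hy) s₀ t) (fun h => g h.2) =
      (stepOp (idKernel N hy) ^ t) g s₀ := by
  induction t generalizing g with
  | zero => rw [historyLaw, expect_pure]; rfl
  | succ t ih =>
    rw [expect_historyLaw_succ, expect_stateActionLaw, pow_succ, Module.End.mul_apply, ← ih]
    congr 1
    ext h
    rw [stepOp_apply, idKernel, expect_bind, idPolicy, expect_map]

theorem avgReward_idPolicy (hy : IsLPFeasible M α y) (s₀ : Fin N → S) (T : ℕ) :
    avgReward M (idPolicy N hy) s₀ T =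
      (1 / (T : ℝ)) * ∑ t ∈ Finset.range T, (stepOp (idKernel N hy) ^ t) (idReward N hy) s₀ := by
  unfold avgReward
  congr 1
  refine Finset.sum_congr rfl fun t _ => ?_
  rw [← expect_historyLaw_idPolicy, ← expect_sum, ← expect_const_mul, expect_stateActionLaw]
  congr 1
  ext h
  rw [idPolicy, expect_map, idReward]

theorem meetsBudget_idPolicy (hy : IsLPFeasible M α y) (hα0 : 0 < α) (hα1 : α < 1) {k : ℕ}
    (hk : α * N = k) (s₀ : Fin N → S) : MeetsBudget M α (idPolicy N hy) s₀ := by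
  intro t x hx
  simp only [stateActionLaw, idPolicy, PMF.mem_support_bind_iff, PMF.mem_support_map_iff] at hx
  obtain ⟨h, -, _, ⟨a, -, rfl⟩, rfl⟩ := hx
  rw [(idRectify_spec hα0 hα1 hk a).1, hk]

/-- The numerical estimate behind the constant of the ID policy; `q` and `σ` are the square roots
of the eigenvalue and of the number of states. -/
theorem gap_constant_le {r q σ β n b γ : ℝ} (hr : 0 ≤ r) (hq : 1 ≤ q) (hσ : 1 ≤ σ) (hβ : 0 < β)
    (hβ1 : β ≤ 1 / 2) (hn : 1 ≤ n) (hb : b = 2 * β / σ) (hγ : γ = b / (6 * q ^ 3)) :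
    r * (σ * (b + 2 * q) + 2) / n ^ 2 *
        (((4 * (2 * q) + 2 * (2 * q) / β) * n / b + 1) / γ) + 4 * r * n / (β * n ^ 2) ≤
      672 * r * q ^ 5 * σ ^ 3 / β ^ 3 / n := by
  have hσb : σ * b = 2 * β := by rw [hb]; field_simp
  have hσ0 : 0 < σ := by linarith
  have hq0 : 0 < q := by linarith
  have hn0 : 0 < n := by linarith
  have hb0 : 0 < b := by rw [hb]; positivity
  have hγ0 : 0 < γ := by rw [hγ]; positivity
  have hqσ : 1 ≤ q * σ := one_le_mul_of_one_le_of_one_le hq hσ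
  -- The main term collects the factors `5` (here) and `15` (in `h4`), and `h7` adds `4`; the total
  -- `79` is well below `672`.
  have h1 : σ * (b + 2 * q) + 2 ≤ 5 * (q * σ) := by
    rw [mul_add, hσb]; nlinarith
  have h2 : (4 * (2 * q) + 2 * (2 * q) / β) * n / b + 1 ≤ 5 * (q * σ) * n / β ^ 2 := by
    have e1 : (4 * (2 * q) + 2 * (2 * q) / β) * n / b = (4 * β + 2) * (q * σ * n) / β ^ 2 := by
      rw [hb]; field_simp
    have h3 : 1 ≤ q * σ * n := one_le_mul_of_one_le_of_one_le hqσ hn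
    rw [e1, ← sub_nonneg]
    have e2 : 5 * (q * σ) * n / β ^ 2 - ((4 * β + 2) * (q * σ * n) / β ^ 2 + 1) =
        ((3 - 4 * β) * (q * σ * n) - β ^ 2) / β ^ 2 := by field_simp; ring
    rw [e2]
    refine div_nonneg ?_ (by positivity)
    nlinarith
  have h4 : ((4 * (2 * q) + 2 * (2 * q) / β) * n / b + 1) / γ ≤
      15 * q ^ 4 * σ ^ 2 * n / β ^ 3 := by
    refine (div_le_div_of_nonneg_right h2 hγ0.le).trans (le_of_eq ?_)
    rw [hγ, hb]; field_simp; norm_num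
  have h5 : r * (σ * (b + 2 * q) + 2) / n ^ 2 ≤ r * (5 * (q * σ)) / n ^ 2 :=
    div_le_div_of_nonneg_right (mul_le_mul_of_nonneg_left h1 hr) (by positivity)
  have h6 := mul_le_mul h5 h4 (by positivity) (by positivity)
  have e3 : r * (5 * (q * σ)) / n ^ 2 * (15 * q ^ 4 * σ ^ 2 * n / β ^ 3) =
      75 * (r * (q ^ 5 * σ ^ 3) / (β ^ 3 * n)) := by field_simp; ring
  have h7 : 4 * r * n / (β * n ^ 2) ≤ 4 * (r * (q ^ 5 * σ ^ 3) / (β ^ 3 * n)) := by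
    have e4 : 4 * r * n / (β * n ^ 2) = 4 * (r * β ^ 2 / (β ^ 3 * n)) := by field_simp
    rw [e4]
    refine mul_le_mul_of_nonneg_left (div_le_div_of_nonneg_right
      (mul_le_mul_of_nonneg_left ?_ hr) (by positivity)) (by norm_num)
    have h8 : 1 ≤ q ^ 5 * σ ^ 3 :=
      one_le_mul_of_one_le_of_one_le (one_le_pow₀ hq) (one_le_pow₀ hσ)
    nlinarith
  have h9 : 0 ≤ r * (q ^ 5 * σ ^ 3) / (β ^ 3 * n) := by positivity
  have e5 : 672 * r * q ^ 5 * σ ^ 3 / β ^ 3 / n = 672 * (r * (q ^ 5 * σ ^ 3) / (β ^ 3 * n)) := by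
    field_simp
  rw [e5]
  rw [e3] at h6
  linarith

/-- The gap between the value of the linear program and the long-run average reward of the ID policy,
in terms of the parameters of an embedding. -/
theorem IsArmEmbedding.lpValue_sub_le_of_drift [Nonempty S] {E : Type*} [NormedAddCommGroup E]
    [InnerProductSpace ℝ E] {u : S → E} {K ρ : ℝ} (hN : 0 < N) (hy : IsLPFeasible M α y)
    (hu : IsArmEmbedding M y (fun s => ∑ a, y s a) u K ρ) (hK : 0 < K) (hρ : 0 ≤ ρ)
    (hα0 : 0 < α) (hα1 : α < 1) {k : ℕ} (hk : α * N = k) {b γ : ℝ} (hb0 : 0 ≤ b)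
    (hb : b = 2 * min α (1 - α) / √(Fintype.card S)) (hγ0 : 0 < γ)
    (hγ : (K + b) * γ ≤ (1 - ρ) * b) (s₀ : Fin N → S) {R : ℝ}
    (hR : Tendsto (fun T => avgReward M (idPolicy N hy) s₀ T) atTop (𝓝 R)) :
    lpValue M y - R ≤ M.rmax * (√(Fintype.card S) * (b + K) + 2) / N *
      (((4 * K + 2 * K / min α (1 - α)) * √N / b + 1) / γ) +
        4 * M.rmax * √N / (min α (1 - α) * N) := by
  simp only [avgReward_idPolicy] at hR
  have hc : 0 ≤ M.rmax * (√(Fintype.card S) * (b + K) + 2) / N :=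
    div_nonneg (mul_nonneg M.rmax_nonneg (by positivity)) (Nat.cast_nonneg N)
  have hdrift := hu.expect_idKernel_unfocused_le hN hy hK hρ hα0 hα1 hk hb hγ0.le hγ
  have hgap := hu.lpValue_sub_idReward_le hN hy hα0 hα1 hk hb
  exact sub_le_of_drift (κ := idKernel N hy) (F := fun s => unfocused b fun i => u (s i))
    (g := idReward N hy) hγ0 (fun s => unfocused_nonneg b _) hc hdrift hgap hR

/-- The long-run average reward of the ID policy is close to the value of the linear program. -/
theorem IsArmEmbedding.lpValue_sub_le [Nonempty S] {E : Type*} [NormedAddCommGroup E]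
    [InnerProductSpace ℝ E] {u : S → E} {l : ℝ} (hl : 1 ≤ l) (hN : 0 < N)
    (hy : IsLPFeasible M α y)
    (hu : IsArmEmbedding M y (fun s => ∑ a, y s a) u (2 * √l) (1 - 1 / (2 * l)))
    (hα0 : 0 < α) (hα1 : α < 1) {k : ℕ} (hk : α * N = k) (s₀ : Fin N → S) {R : ℝ}
    (hR : Tendsto (fun T => avgReward M (idPolicy N hy) s₀ T) atTop (𝓝 R)) :
    lpValue M y - R ≤ (672 * M.rmax * l ^ (5 / 2 : ℝ) * (Fintype.card S : ℝ) ^ (3 / 2 : ℝ)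
      / (min α (1 - α)) ^ 3) / √N := by
  have hl0 : 0 ≤ l := by linarith
  have hrpow : ∀ (x : ℝ) (m : ℕ), 0 ≤ x → x ^ ((m : ℝ) / 2) = √x ^ m := fun x m hx => by
    rw [Real.sqrt_eq_rpow, ← Real.rpow_natCast, ← Real.rpow_mul hx]
    congr 1
    ring
  have e1 : l ^ (5 / 2 : ℝ) = √l ^ 5 := hrpow l 5 hl0
  have e2 : (Fintype.card S : ℝ) ^ (3 / 2 : ℝ) = √(Fintype.card S) ^ 3 :=
    hrpow (Fintype.card S) 3 (Nat.cast_nonneg _)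
  rw [e1, e2]
  have hβ0 : 0 < min α (1 - α) := lt_min hα0 (by linarith)
  have hβ1 : min α (1 - α) ≤ 1 / 2 := by
    linarith [min_le_left α (1 - α), min_le_right α (1 - α)]
  have hq : 1 ≤ √l := Real.one_le_sqrt.2 hl
  have hσ : 1 ≤ √(Fintype.card S : ℝ) :=
    Real.one_le_sqrt.2 (by exact_mod_cast Fintype.card_pos)
  have hn : 1 ≤ √(N : ℝ) := Real.one_le_sqrt.2 (by exact_mod_cast hN)
  have hn2 : √(N : ℝ) ^ 2 = N := Real.sq_sqrt (Nat.cast_nonneg _)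
  have hq2 : √l ^ 2 = l := Real.sq_sqrt hl0
  set β := min α (1 - α) with hβ
  set q := √l with hqdef
  set σ := √(Fintype.card S : ℝ) with hσdef
  set b := 2 * β / σ with hb
  have hb0 : 0 < b := by positivity
  have hb1 : b ≤ 1 := by rw [hb, div_le_one (by positivity)]; linarith
  -- Since `b ≤ 1 ≤ q`, one has `2 * q + b ≤ 3 * q`; this `γ` solves `3 * q * γ = b / (2 * q ^ 2)`,
  -- the right side being `(1 - ρ) * b`.
  set γ := b / (6 * q ^ 3) with hγ
  have hγ0 : 0 < γ := by positivity
  have hρ : 0 ≤ 1 - 1 / (2 * l) := by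
    rw [sub_nonneg, div_le_one (by positivity)]; linarith
  have hKγ : (2 * q + b) * γ ≤ (1 - (1 - 1 / (2 * l))) * b := by
    have h1 : (2 * q + b) * γ ≤ (3 * q) * γ :=
      mul_le_mul_of_nonneg_right (by linarith) hγ0.le
    have h2 : (3 * q) * γ = (1 - (1 - 1 / (2 * l))) * b := by
      rw [hγ, ← hq2]; field_simp; ring
    linarith
  have h := gap_constant_le M.rmax_nonneg hq hσ hβ0 hβ1 hn hb hγ
  rw [hn2] at h
  exact (hu.lpValue_sub_le_of_drift hN hy (by positivity) hρ hα0 hα1 hk hb0.le hb hγ0 hKγ s₀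
    hR).trans h

end LongRun

end

end RestlessBandit

theorem theorem2 {S : Type*} [Fintype S] [DecidableEq S]
    (M : RestlessBandit.MDP S) (α : ℝ) (hα0 : 0 < α) (hα1 : α < 1)
    (y : S → Fin 2 → ℝ) (hy : RestlessBandit.IsLPOptimal M α y)
    (hchain : RestlessBandit.IsAperiodicUnichain (RestlessBandit.singleArmMatrix M y)) :
    ∃ (μ : S → ℝ) (W : Matrix S S ℝ) (lam : ℝ),
      RestlessBandit.IsStationary (RestlessBandit.singleArmMatrix M y) μ ∧
      (∀ ν, RestlessBandit.IsStationary (RestlessBandit.singleArmMatrix M y) ν → ν = μ) ∧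
      RestlessBandit.IsWeightMatrix (RestlessBandit.singleArmMatrix M y) μ W ∧
      RestlessBandit.IsMaxEigenvalue W lam ∧
      ∀ (N : ℕ), 0 < N → (∃ k : ℕ, α * N = k) → ∀ s₀ : Fin N → S,
        RestlessBandit.MeetsBudget M α (RestlessBandit.idPolicy N hy.feasible) s₀ ∧
        ∃ R : ℝ,
          Filter.Tendsto
            (fun T => RestlessBandit.avgReward M (RestlessBandit.idPolicy N hy.feasible) s₀ T)
            Filter.atTop (nhds R) ∧
          RestlessBandit.optReward M N α s₀ - R ≤
            (672 * M.rmax * lam ^ (5 / 2 : ℝ) * (Fintype.card S : ℝ) ^ (3 / 2 : ℝ)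
                / (min α (1 - α)) ^ 3) / Real.sqrt N := by
  have hQ := hy.feasible.isStochastic
  have hμ := hy.feasible.isStationary
  have : Nonempty S := let ⟨s, _⟩ := hchain.exists_recurrent; ⟨s⟩
  obtain ⟨W, hW⟩ := hchain.exists_isWeightMatrix hQ hμ
  obtain ⟨l, hl⟩ := RestlessBandit.exists_isMaxEigenvalue hW.isHermitian
  obtain ⟨hl1, u, hu⟩ := hW.exists_isArmEmbedding hy.feasible hl
  -- The stationary law is the state marginal `fun s => ∑ a, y s a` of the optimal solution.
  refine ⟨_, W, l, hμ, fun ν hν => hchain.stationary_unique hQ hμ hν, hW, hl, ?_⟩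
  rintro N hN ⟨k, hk⟩ s₀
  have hbudget := RestlessBandit.meetsBudget_idPolicy hy.feasible hα0 hα1 hk s₀
  obtain ⟨R, hR⟩ := RestlessBandit.exists_tendsto_cesaro
    (RestlessBandit.idKernel N hy.feasible) (RestlessBandit.idReward N hy.feasible) s₀
  simp only [← RestlessBandit.avgReward_idPolicy] at hR
  refine ⟨hbudget, R, hR, ?_⟩
  have h1 := hy.optReward_le hN hbudget
  have h2 := hu.lpValue_sub_le hl1 hN hy.feasible hα0 hα1 hk s₀ hR
  linarith
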